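/- **Setting.** Let $n,d_1,d_2\ge 1$ with $nd_1d_2\ge 2$, and let $D_n=((X_k,Y_k))_{k\le n}$ be i.i.d. copies of $(X,Y)\sim\mathbb P$ with values in $([d_1]\times[d_2])\times\{-1,+1\}$. A matrix $M\in\mathbb R^{d_1\times d_2}$ predicts $Y$ by $\mathrm{sign}(M_X)\in\{-1,1\}$ (with $\mathrm{sign}(0)=1$). Put $R_{0/1}(M)=\mathbb P(Y\ne\mathrm{sign}(M_X))$, $R^*_{0/1}=\inf_f\mathbb P(Y\neq f(X))$ over all $f:[d_1]\times[d_2]\to\{-1,1\}$, $R^h(M)=\mathbb E(1-YM_X)_+$ and $r_n^h(M)=\frac1n\sum_{k}(1-Y_kM_{X_k})_+$. Write $p(x)=\mathbb P(Y=1\mid X=x)$. *Prior.* The parameter is $\theta=(L,R,\gamma)\in\mathbb R^{d_1\times m}\times\mathbb R^{d_2\times m}\times\mathbb R^m$, with predictor $M_\theta=LR^\top$. In the hierarchical model the $\gamma_k$ are i.i.d. from $\pi^\gamma$, which is either the Gamma distribution (shape $a$, rate $b$) or the inverse-Gamma distribution (shape $a$, scale $b$) and, given $\gamma$, the rows of $L$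 and $R$ are i.i.d. $\mathcal N(0,\mathrm{diag}(\gamma))$. For $B\ge2$ let $\Theta$ be the set of all $\theta$ for which the hinge loss takes values in $[0,B]$, that is $(1-y(LR^\top)_{ij})_+\le B$ for all $i,j$ and $y=\pm1$. The prior $\pi$ is the law of the hierarchical model conditioned on $\Theta$. *Posterior, VB approximation, estimators.* For $\lambda>0$ let $\hat\rho_\lambda(d\theta)\propto\exp[-\lambda r_n^h(LR^\top)]\,\pi(d\theta)$. Let $\mathcal F$ be a family of probability distributions on the parameter space that contains all the fully factorized ones (all coordinates of $L,R,\gamma$ independent), and let $\tilde\rho_\lambda\in\arg\min_{\rho\in\mathcal F}\mathcal K(\rho\|\hat\rho_\lambda)$, for each sample. The estimator $\hat\theta$ is the mean of $LR^\top$, either under $\tilde\rho_\lambda$ or under $\hat\rho_\lambda$. *Assumptions.* (i) $M^*=\bar U\bar V^\top$ is a Bayes matrix: its entries are $\pm1$ and $M^*_x=\mathrm{sign}\,\mathbb E(Y\mid X=x)$ wherever this conditional expectation is defined and nonzero. Here $\bar U\in\mathbb R^{d_1\times m}$ and $\bar V\in\mathbb R^{d_2\times m}$ have entries bounded by $A>0$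 in absolute value, and only their first $r$ columns may be nonzero, $r\ge1$. (ii) Bernstein condition: for some $K>0$ and all $\theta\in\Theta$, $\mathbb E[(M_{\theta,X}-M^*_X)^2]\le K\,[R^h(M_\theta)-R^h(M^*)]$. (It is implied by the same inequality with $\|M_\theta-M^*\|_F^2$ on the left.) (iii) Margin condition: $\mathbb P\{0<|p(X)-1/2|<1/(2c)\}=0$ for some $c>0$. (iv) With a constant $\kappa\ge1$: $\frac{1}{\kappa\,(nd_1d_2)^{\kappa}}\le b\le\kappa$, and one of the following holds: $m\le\kappa r$; or $m\le\kappa(d_1+d_2)$ and either $\pi^\gamma$ is the Gamma distribution or $b\le\kappa (nd_1d_2)^{-4}$. (For fixed $m$ and $b$ this always holds, with $\kappa=\max(m,b,1/b,1)$.) **Theorem.** For all $K>0$, $B\ge2$, $A>0$, $a>0$, $\kappa\ge1$ there is a constant $C>0$, depending on these numbers only, such that in the setting above, with $\lambda=n/\max(2K,B)$, $$\mathbb E\big[\mathbb E_{\theta\sim\tilde\rho_\lambda}[R_{0/1}(M_\theta)]\big]-R^*_{0/1}\le C\,\frac{r(d_1+d_2)\log(nd_1d_2)}{n}$$ and, for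 both choices of the estimator $\hat\theta$, $$\mathbb E[R_{0/1}(\hat\theta)]-R^*_{0/1}\le C\,\frac{r(d_1+d_2)\log(nd_1d_2)}{n}.$$ -/

import Mathlib

open MeasureTheory ProbabilityTheory
open scoped ENNReal

noncomputable section

namespace OneBit

/-- Positions in a `d1 × d2` matrix (the covariates). -/
abbrev Cell (d1 d2 : ℕ) : Type := Fin d1 × Fin d2

/-- One observation `(X, Y)`: a position and a label, `true` standing for `+1` and `false` for
`-1`. -/
abbrev Obs (d1 d2 : ℕ) : Type := Cell d1 d2 × Bool

/-- The numerical value `±1` of a label. -/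
def labelVal (y : Bool) : ℝ := if y then 1 else -1

/-- The sign of a real number, as a label (the value at `0` is `+1`). -/
def sgn (t : ℝ) : Bool := decide (0 ≤ t)

/-! ### The law of one observation -/

/-- The probability `p(x) = ℙ(Y = 1 ∣ X = x)`. -/
def condProb {d1 d2 : ℕ} (P : Measure (Obs d1 d2)) (x : Cell d1 d2) : ℝ :=
  P.real {(x, true)} / P.real {z | z.1 = x}

/-- The regression function `η(x) = 𝔼(Y ∣ X = x)` (it is `0` at the positions that are never
observed). -/
def regression {d1 d2 : ℕ} (P : Measure (Obs d1 d2)) (x : Cell d1 d2) : ℝ :=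
  (P.real {(x, true)} - P.real {(x, false)}) / P.real {z | z.1 = x}

/-- `M = sign η` with values in `{-1, 1}`; where `η = 0` either sign is allowed. -/
def IsBayesMatrix {d1 d2 : ℕ} (P : Measure (Obs d1 d2)) (M : Matrix (Fin d1) (Fin d2) ℝ) : Prop :=
  ∀ i j, (M i j = 1 ∨ M i j = -1) ∧
    (0 < regression P (i, j) → M i j = 1) ∧ (regression P (i, j) < 0 → M i j = -1)

/-- The margin (low-noise) condition with constant `c`. -/
def MarginCondition {d1 d2 : ℕ} (P : Measure (Obs d1 d2)) (c : ℝ) : Prop :=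
  P {z | 0 < |condProb P z.1 - 1 / 2| ∧ |condProb P z.1 - 1 / 2| < 1 / (2 * c)} = 0

/-! ### Risks -/

/-- Misclassification risk `ℙ(Y ≠ sign M_X)` of the classifier `sign M`. It is at least
`ℙ(Y * M_X < 0)`. -/
def misclassRisk {d1 d2 : ℕ} (P : Measure (Obs d1 d2)) (M : Matrix (Fin d1) (Fin d2) ℝ) : ℝ :=
  P.real {z | z.2 ≠ sgn (M z.1.1 z.1.2)}

/-- The Bayes risk: the least misclassification probability over all classifiers. -/
def bayesRisk {d1 d2 : ℕ} (P : Measure (Obs d1 d2)) : ℝ :=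
  ⨅ f : Cell d1 d2 → Bool, P.real {z | z.2 ≠ f z.1}

/-- The hinge loss `(1 - y t)₊`. -/
def hinge (y t : ℝ) : ℝ := max (1 - y * t) 0

/-- The hinge risk `𝔼 (1 - Y M_X)₊`. -/
def hingeRisk {d1 d2 : ℕ} (P : Measure (Obs d1 d2)) (M : Matrix (Fin d1) (Fin d2) ℝ) : ℝ :=
  ∫ z, hinge (labelVal z.2) (M z.1.1 z.1.2) ∂P

/-- The empirical hinge risk of a sample of size `n`. -/
def empHingeRisk {d1 d2 n : ℕ} (D : Fin n → Obs d1 d2) (M : Matrix (Fin d1) (Fin d2) ℝ) : ℝ :=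
  (1 / (n : ℝ)) * ∑ k, hinge (labelVal (D k).2) (M (D k).1.1 (D k).1.2)

/-- The squared distance `𝔼 (M_X - M'_X)²` between two predictors, in `L²` of the law of `X`.
It is at most the squared Frobenius distance. -/
def sqDist {d1 d2 : ℕ} (P : Measure (Obs d1 d2)) (M M' : Matrix (Fin d1) (Fin d2) ℝ) : ℝ :=
  ∫ z, (M z.1.1 z.1.2 - M' z.1.1 z.1.2) ^ 2 ∂P

/-! ### Parameters and prior -/

/-- Parameters `θ = (L, R, γ)`: the two factors (with `m` columns) and the column variances. -/
abbrev Params (d1 d2 m : ℕ) : Type :=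
  (Fin d1 → Fin m → ℝ) × (Fin d2 → Fin m → ℝ) × (Fin m → ℝ)

/-- The matrix `L Rᵀ` of the parameter `(L, R, γ)`. -/
def toMatrix {d1 d2 m : ℕ} (θ : Params d1 d2 m) : Matrix (Fin d1) (Fin d2) ℝ :=
  Matrix.of θ.1 * (Matrix.of θ.2.1).transpose

/-- The two families of laws for the variances. -/
inductive VarianceFamily
  | gamma
  | invGamma

/-- Density of the inverse-Gamma distribution with shape `a` and scale `b`. -/
def invGammaPDF (a b x : ℝ) : ℝ≥0∞ :=
  ENNReal.ofReal (if 0 < x then b ^ a / Real.Gamma a * x ^ (-a - 1) * Real.exp (-(b / x)) else 0)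

/-- Density of the law `π^γ`: Gamma with shape `a` and rate `b`, or inverse-Gamma with shape `a`
and scale `b`. -/
def variancePDF : VarianceFamily → ℝ → ℝ → ℝ → ℝ≥0∞
  | .gamma, a, b, x => gammaPDF a b x
  | .invGamma, a, b, x => invGammaPDF a b x

/-- Joint law of the hierarchical model: the `γ k` are i.i.d. from `π^γ` and, given `γ`, the rows of
`L` and `R` are i.i.d. from `𝒩(0, diag γ)`. -/
def hierarchicalPrior (d1 d2 m : ℕ) (fam : VarianceFamily) (a b : ℝ) : Measure (Params d1 d2 m) :=
  (volume : Measure (Params d1 d2 m)).withDensity fun θ =>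
    ∏ k, (variancePDF fam a b (θ.2.2 k) *
      (∏ i, gaussianPDF 0 (θ.2.2 k).toNNReal (θ.1 i k)) *
      (∏ j, gaussianPDF 0 (θ.2.2 k).toNNReal (θ.2.1 j k)))

/-- The parameter set `Θ`: the parameters for which the hinge loss takes its values in `[0, B]`,
for both labels and at every position. -/
def paramSet (d1 d2 m : ℕ) (B : ℝ) : Set (Params d1 d2 m) :=
  {θ | ∀ (i : Fin d1) (j : Fin d2) (y : Bool), hinge (labelVal y) (toMatrix θ i j) ≤ B}

/-- The prior on `Θ`: the hierarchical law conditioned on `Θ`. -/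
def prior (d1 d2 m : ℕ) (fam : VarianceFamily) (a b B : ℝ) : Measure (Params d1 d2 m) :=
  cond (hierarchicalPrior d1 d2 m fam a b) (paramSet d1 d2 m B)

/-! ### Gibbs posterior and variational approximation -/

/-- The Gibbs posterior `∝ exp (-lam * r_n^h(L Rᵀ)) π(dθ)`. -/
def gibbs {d1 d2 m n : ℕ} (π : Measure (Params d1 d2 m)) (lam : ℝ) (D : Fin n → Obs d1 d2) :
    Measure (Params d1 d2 m) :=
  π.tilted fun θ => -lam * empHingeRisk D (toMatrix θ)

/-- The fully factorized distributions of `(L, R, γ)`: all coordinates are independent. -/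
def fullyFactorized (d1 d2 m : ℕ) : Set (Measure (Params d1 d2 m)) :=
  {ρ | ∃ (p : Fin d1 → Fin m → Measure ℝ) (q : Fin d2 → Fin m → Measure ℝ) (g : Fin m → Measure ℝ),
    (∀ i k, IsProbabilityMeasure (p i k)) ∧ (∀ j k, IsProbabilityMeasure (q j k)) ∧
    (∀ k, IsProbabilityMeasure (g k)) ∧
    ρ = (Measure.pi fun i => Measure.pi (p i)).prod
      ((Measure.pi fun j => Measure.pi (q j)).prod (Measure.pi g))}

/-- `ρ` is a minimizer over the family `F` of the Kullback-Leibler divergence to `ν`. -/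
def IsVBApprox {d1 d2 m : ℕ} (F : Set (Measure (Params d1 d2 m))) (ν ρ : Measure (Params d1 d2 m)) :
    Prop :=
  ρ ∈ F ∧ ∀ ρ' ∈ F, InformationTheory.klDiv ρ ν ≤ InformationTheory.klDiv ρ' ν

/-- The mean estimator: the mean of the matrix `L Rᵀ` under `ρ`. -/
def meanMatrix {d1 d2 m : ℕ} (ρ : Measure (Params d1 d2 m)) : Matrix (Fin d1) (Fin d2) ℝ :=
  Matrix.of fun i j => ∫ θ, toMatrix θ i j ∂ρ

/-- The class of pairs of factors with entries bounded by `A` in absolute value, in which only the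
first `r` columns may be nonzero. -/
def factorClass (d1 d2 m r : ℕ) (A : ℝ) :
    Set (Matrix (Fin d1) (Fin m) ℝ × Matrix (Fin d2) (Fin m) ℝ) :=
  {W | (∀ i k, |W.1 i k| ≤ A) ∧ (∀ j k, |W.2 j k| ≤ A) ∧
    (∀ i (k : Fin m), r ≤ (k : ℕ) → W.1 i k = 0) ∧
    (∀ j (k : Fin m), r ≤ (k : ℕ) → W.2 j k = 0)}

end OneBit

end

/-
By the Donsker–Varadhan inequality, the excess hinge risk of a law `ρ` that is at least as close to
the Gibbs posterior as a competitor `ρ'` is controlled, in expectation over the sample, by the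
excess hinge risk of `ρ'` and by `klDiv ρ' π / lam`; the Bernstein condition makes the exponential
moments of the empirical excess risk small enough for a fast rate. The competitor is fully
factorized. In the active columns (the first `r` ones, or all of them when `m` is of order `r`) the
entries of `L` and `R` are uniform on small intervals around slightly shrunk factors of the Bayes
matrix and the variances are of order `1`; in the other columns the entries are truncated centered
Gaussians whose tiny variance is also where the column variances concentrate. Its divergence to the
prior is of order `r * (d1 + d2) * log (n * d1 * d2)`. Zhang's inequality bounds the excess
misclassification risk by the excess hinge risk, and Jensen's inequality transfers the bound to the
mean matrix.
-/

namespace OneBit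

section KullbackLeibler

open InformationTheory

variable {α : Type*} {mα : MeasurableSpace α}

lemma rnDeriv_le_of_le_smul {ρ μ : Measure α} [SigmaFinite μ] {c : ℝ≥0∞} (h : ρ ≤ c • μ) :
    ∀ᵐ x ∂μ, ρ.rnDeriv μ x ≤ c := by
  refine ae_le_of_forall_setLIntegral_le_of_sigmaFinite (Measure.measurable_rnDeriv _ _)
    fun s _ _ => ?_
  calc ∫⁻ x in s, ρ.rnDeriv μ x ∂μ ≤ ρ s := Measure.setLIntegral_rnDeriv_le s
    _ ≤ c * μ s := h s
    _ = ∫⁻ _ in s, c ∂μ := (setLIntegral_const s c).symm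

lemma klFun_le_of_le_exp {x C : ℝ} (hx : 0 ≤ x) (hxC : x ≤ Real.exp C) :
    klFun x ≤ x * C + 1 - x := by
  rw [klFun_apply]
  rcases hx.eq_or_lt with rfl | hpos
  · simp
  · gcongr
    exact (Real.log_le_iff_le_exp hpos).mpr hxC

lemma klDiv_le_of_le_smul {ρ μ : Measure α} [IsProbabilityMeasure ρ] [IsProbabilityMeasure μ]
    {C : ℝ} (h : ρ ≤ ENNReal.ofReal (Real.exp C) • μ) : klDiv ρ μ ≤ ENNReal.ofReal C := by
  have hac : ρ ≪ μ := (Measure.absolutelyContinuous_of_le h).trans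
    Measure.smul_absolutelyContinuous
  set p : α → ℝ := fun x => (ρ.rnDeriv μ x).toReal with hp
  have hp_int : Integrable p μ := Measure.integrable_toReal_rnDeriv
  have hklFun : ∀ᵐ x ∂μ, klFun (p x) ≤ p x * C + 1 - p x := by
    filter_upwards [rnDeriv_le_of_le_smul h] with x hx
    exact klFun_le_of_le_exp ENNReal.toReal_nonneg
      (ENNReal.toReal_le_of_le_ofReal (Real.exp_pos _).le hx)
  have hbound_int : Integrable (fun x => p x * C + 1 - p x) μ := by fun_prop
  calc klDiv ρ μ = ∫⁻ x, ENNReal.ofReal (klFun (p x)) ∂μ := klDiv_eq_lintegral_klFun_of_ac hac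
    _ ≤ ∫⁻ x, ENNReal.ofReal (p x * C + 1 - p x) ∂μ :=
        lintegral_mono_ae (hklFun.mono fun x hx => ENNReal.ofReal_le_ofReal hx)
    _ = ENNReal.ofReal (∫ x, (p x * C + 1 - p x) ∂μ) :=
        (ofReal_integral_eq_lintegral_ofReal hbound_int
          (hklFun.mono fun x hx => (klFun_nonneg ENNReal.toReal_nonneg).trans hx)).symm
    _ = ENNReal.ofReal C := by
        rw [integral_sub (by fun_prop) hp_int, integral_add (by fun_prop) (integrable_const 1),
          integral_mul_const, hp, Measure.integral_toReal_rnDeriv hac]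
        simp

lemma klDiv_tilted_right_ne_top {ρ π : Measure α} [IsFiniteMeasure ρ] [SigmaFinite π]
    {f : α → ℝ} (hkl : klDiv ρ π ≠ ∞) (hf : Integrable f ρ)
    (hexp : Integrable (fun x => Real.exp (f x)) π) : klDiv ρ (π.tilted f) ≠ ∞ := by
  obtain ⟨hac, hllr⟩ := klDiv_ne_top_iff.mp hkl
  exact klDiv_ne_top (hac.trans (absolutelyContinuous_tilted hexp))
    (integrable_llr_tilted_right hac hf hllr hexp)

lemma toReal_klDiv_tilted_right {ρ π : Measure α} [IsProbabilityMeasure ρ]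
    [IsProbabilityMeasure π] {f : α → ℝ} (hkl : klDiv ρ π ≠ ∞) (hf : Integrable f ρ)
    (hexp : Integrable (fun x => Real.exp (f x)) π) :
    (klDiv ρ (π.tilted f)).toReal =
      (klDiv ρ π).toReal - ∫ x, f x ∂ρ + Real.log (∫ x, Real.exp (f x) ∂π) := by
  obtain ⟨hac, hllr⟩ := klDiv_ne_top_iff.mp hkl
  have := isProbabilityMeasure_tilted hexp
  rw [toReal_klDiv_of_measure_eq (hac.trans (absolutelyContinuous_tilted hexp)) (by simp),
    toReal_klDiv_of_measure_eq hac (by simp), integral_llr_tilted_right hac hf hexp hllr]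

lemma integral_le_klDiv_add_log {ρ π : Measure α} [IsProbabilityMeasure ρ]
    [IsProbabilityMeasure π] {f : α → ℝ} (hkl : klDiv ρ π ≠ ∞) (hf : Integrable f ρ)
    (hexp : Integrable (fun x => Real.exp (f x)) π) :
    ∫ x, f x ∂ρ ≤ (klDiv ρ π).toReal + Real.log (∫ x, Real.exp (f x) ∂π) := by
  have hnonneg : 0 ≤ (klDiv ρ (π.tilted f)).toReal := ENNReal.toReal_nonneg
  rw [toReal_klDiv_tilted_right hkl hf hexp] at hnonneg
  linarith

lemma integrable_exp_of_abs_le {π : Measure α} [IsFiniteMeasure π] {f : α → ℝ} {C : ℝ}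
    (hf : AEStronglyMeasurable f π) (hfC : ∀ᵐ x ∂π, |f x| ≤ C) :
    Integrable (fun x => Real.exp (f x)) π := by
  refine .of_bound (Real.continuous_exp.comp_aestronglyMeasurable hf) (Real.exp C) ?_
  filter_upwards [hfC] with x hx
  rw [Real.norm_eq_abs, Real.abs_exp]
  exact Real.exp_le_exp.mpr (le_of_abs_le hx)

lemma integrable_of_absolutelyContinuous_of_abs_le {ρ π : Measure α} [IsFiniteMeasure ρ]
    {f : α → ℝ} {C : ℝ} (hρ : ρ ≪ π) (hf : Measurable f) (hfC : ∀ᵐ x ∂π, |f x| ≤ C) :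
    Integrable f ρ :=
  .of_bound hf.aestronglyMeasurable C (hρ hfC)

lemma klDiv_tilted_right_ne_top_iff {ρ π : Measure α} [IsFiniteMeasure ρ] [IsProbabilityMeasure π]
    {f : α → ℝ} {C : ℝ} (hf : Measurable f) (hfC : ∀ᵐ x ∂π, |f x| ≤ C) :
    klDiv ρ (π.tilted f) ≠ ∞ ↔ klDiv ρ π ≠ ∞ := by
  have hexp := integrable_exp_of_abs_le hf.aestronglyMeasurable hfC
  have hac := tilted_absolutelyContinuous π f
  constructor <;> intro hkl
  · have := isProbabilityMeasure_tilted hexp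
    have hρ : ρ ≪ π := (klDiv_ne_top_iff.mp hkl).1.trans hac
    have hfC' : ∀ᵐ x ∂(π.tilted f), |f x| ≤ C := hac hfC
    have hexp_neg : Integrable (fun x => Real.exp ((-f) x)) (π.tilted f) :=
      integrable_exp_of_abs_le hf.neg.aestronglyMeasurable
        (by simpa only [Pi.neg_apply, abs_neg] using hfC')
    simpa only [tilted_neg_same hexp] using klDiv_tilted_right_ne_top hkl
      (integrable_of_absolutelyContinuous_of_abs_le hρ hf hfC).neg hexp_neg
  · exact klDiv_tilted_right_ne_top hkl (integrable_of_absolutelyContinuous_of_abs_le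
      (klDiv_ne_top_iff.mp hkl).1 hf hfC) hexp

-- Both divergences to the Gibbs measure contain the same normalizing constant.
lemma klDiv_add_integral_le_of_klDiv_tilted_le {π ρ ρ' : Measure α} [IsProbabilityMeasure π]
    [IsProbabilityMeasure ρ] [IsProbabilityMeasure ρ'] {f : α → ℝ}
    (hf : Integrable f ρ) (hf' : Integrable f ρ') (hexp : Integrable (fun x => Real.exp ((-f) x)) π)
    (hρ : klDiv ρ π ≠ ∞) (hρ' : klDiv ρ' π ≠ ∞)
    (hkl : klDiv ρ (π.tilted (-f)) ≤ klDiv ρ' (π.tilted (-f))) :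
    (klDiv ρ π).toReal + ∫ x, f x ∂ρ ≤ (klDiv ρ' π).toReal + ∫ x, f x ∂ρ' := by
  have h := ENNReal.toReal_mono (klDiv_tilted_right_ne_top hρ' hf'.neg hexp) hkl
  rw [toReal_klDiv_tilted_right hρ hf.neg hexp, toReal_klDiv_tilted_right hρ' hf'.neg hexp,
    integral_neg', integral_neg'] at h
  linarith

lemma integral_le_of_klDiv_tilted_le {π ρ ρ' : Measure α} [IsProbabilityMeasure π]
    [IsProbabilityMeasure ρ] [IsProbabilityMeasure ρ'] {f g : α → ℝ} {F G : ℝ}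
    (hf : Measurable f) (hg : Measurable g) (hfF : ∀ᵐ x ∂π, |f x| ≤ F)
    (hgG : ∀ᵐ x ∂π, |g x| ≤ G) (hρ' : klDiv ρ' π ≠ ∞)
    (hkl : klDiv ρ (π.tilted (-f)) ≤ klDiv ρ' (π.tilted (-f))) :
    ∫ x, g x ∂ρ ≤ (klDiv ρ' π).toReal + ∫ x, f x ∂ρ' +
      Real.log (∫ x, Real.exp (g x - f x) ∂π) := by
  have hfF_neg : ∀ᵐ x ∂π, |(-f) x| ≤ F := by simpa using hfF
  have hρ : klDiv ρ π ≠ ∞ := by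
    rw [← klDiv_tilted_right_ne_top_iff hf.neg hfF_neg] at hρ' ⊢
    exact ne_top_of_le_ne_top hρ' hkl
  have hρ_ac : ρ ≪ π := (klDiv_ne_top_iff.mp hρ).1
  have hf_int := integrable_of_absolutelyContinuous_of_abs_le hρ_ac hf hfF
  have hg_int := integrable_of_absolutelyContinuous_of_abs_le hρ_ac hg hgG
  have hf_int' := integrable_of_absolutelyContinuous_of_abs_le (klDiv_ne_top_iff.mp hρ').1 hf hfF
  have hfree := klDiv_add_integral_le_of_klDiv_tilted_le hf_int hf_int'
    (integrable_exp_of_abs_le hf.neg.aestronglyMeasurable hfF_neg) hρ hρ' hkl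
  have hgf : ∀ᵐ x ∂π, |g x - f x| ≤ G + F := by
    filter_upwards [hfF, hgG] with x h₁ h₂ using (abs_sub _ _).trans (add_le_add h₂ h₁)
  have hDV := integral_le_klDiv_add_log hρ (hg_int.sub hf_int)
    (integrable_exp_of_abs_le (hg.sub hf).aestronglyMeasurable hgf)
  rw [integral_sub' hg_int hf_int] at hDV
  simp only [Pi.sub_apply] at hDV
  linarith

-- `log x ≤ x - 1` linearizes the logarithm of the exponential moment, so that Fubini's theorem
-- bounds its mean.
lemma integral_integral_le_of_klDiv_tilted_le {𝒟 : Type*} [Finite 𝒟] [MeasurableSpace 𝒟]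
    [MeasurableSingletonClass 𝒟] {ν : Measure 𝒟} [IsProbabilityMeasure ν] {π ρ' : Measure α}
    [IsProbabilityMeasure π] [IsProbabilityMeasure ρ'] {ρ : 𝒟 → Measure α}
    [∀ D, IsProbabilityMeasure (ρ D)] {f : 𝒟 → α → ℝ} {g : α → ℝ} {b c F G : ℝ}
    (hf : ∀ D, Measurable (f D)) (hg : Measurable g) (hfF : ∀ D, ∀ᵐ x ∂π, |f D x| ≤ F)
    (hgG : ∀ᵐ x ∂π, |g x| ≤ G) (hρ' : klDiv ρ' π ≤ ENNReal.ofReal c) (hc : 0 ≤ c)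
    (hfb : ∀ D, ∀ᵐ x ∂ρ', f D x ≤ b)
    (hkl : ∀ D, klDiv (ρ D) (π.tilted (-f D)) ≤ klDiv ρ' (π.tilted (-f D)))
    (hmoment : ∀ᵐ x ∂π, ∫ D, Real.exp (g x - f D x) ∂ν ≤ 1) :
    ∫ D, ∫ x, g x ∂(ρ D) ∂ν ≤ c + b := by
  have hgf (D : 𝒟) : ∀ᵐ x ∂π, |g x - f D x| ≤ G + F := by
    filter_upwards [hfF D, hgG] with x h₁ h₂ using (abs_sub _ _).trans (add_le_add h₂ h₁)
  have hexp (D : 𝒟) : Integrable (fun x => Real.exp (g x - f D x)) π :=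
    integrable_exp_of_abs_le (hg.sub (hf D)).aestronglyMeasurable (hgf D)
  have hρ'_ne_top := ne_top_of_le_ne_top ENNReal.ofReal_ne_top hρ'
  have hsample (D : 𝒟) :
      ∫ x, g x ∂(ρ D) ≤ c + b - 1 + ∫ x, Real.exp (g x - f D x) ∂π := by
    have hloc := integral_le_of_klDiv_tilted_le (hf D) hg (hfF D) hgG hρ'_ne_top (hkl D)
    have hfint := integrable_of_absolutelyContinuous_of_abs_le
      (klDiv_ne_top_iff.mp hρ'_ne_top).1 (hf D) (hfF D)
    have hfρ' : ∫ x, f D x ∂ρ' ≤ b := by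
      simpa using integral_mono_ae hfint (integrable_const b) (hfb D)
    have hlog := Real.log_le_sub_one_of_pos (integral_exp_pos (hexp D))
    linarith [ENNReal.toReal_le_of_le_ofReal hc hρ']
  have hfubini : ∫ D, ∫ x, Real.exp (g x - f D x) ∂π ∂ν ≤ 1 := by
    have hmeas : Measurable (Function.uncurry fun D x => g x - f D x) :=
      measurable_from_prod_countable_right fun D => hg.sub (hf D)
    have hprod : Integrable (Function.uncurry fun D x => Real.exp (g x - f D x)) (ν.prod π) :=
      integrable_exp_of_abs_le hmeas.aestronglyMeasurable
        ((Measure.ae_prod_iff_ae_ae (measurableSet_le hmeas.abs measurable_const)).mpr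
          (.of_forall hgf))
    rw [integral_integral_swap hprod]
    simpa using integral_mono_ae hprod.integral_prod_right (integrable_const 1) hmoment
  calc ∫ D, ∫ x, g x ∂(ρ D) ∂ν
      ≤ ∫ D, (c + b - 1 + ∫ x, Real.exp (g x - f D x) ∂π) ∂ν :=
        integral_mono .of_finite .of_finite hsample
    _ = c + b - 1 + ∫ D, ∫ x, Real.exp (g x - f D x) ∂π ∂ν := by
        rw [integral_add .of_finite .of_finite]; simp
    _ ≤ c + b := by linarith

end KullbackLeibler

section Hinge

lemma abs_labelVal (y : Bool) : |labelVal y| = 1 := by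
  cases y <;> simp [labelVal]

lemma hinge_nonneg (y t : ℝ) : 0 ≤ hinge y t := le_max_right _ _

@[fun_prop]
lemma measurable_hinge (y : ℝ) : Measurable (hinge y) := by
  unfold hinge; fun_prop

lemma abs_hinge_sub_hinge_le (y s t : ℝ) : |hinge y s - hinge y t| ≤ |y| * |s - t| :=
  calc |hinge y s - hinge y t| ≤ |1 - y * s - (1 - y * t)| := abs_max_sub_max_le_abs _ _ _
    _ = |y| * |s - t| := by rw [← abs_mul, ← abs_neg]; ring_nf

lemma hinge_le_one_add_abs {y : ℝ} (hy : |y| = 1) (t : ℝ) : hinge y t ≤ 1 + |t| := by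
  refine max_le ?_ (by positivity)
  have h : -(y * t) ≤ |t| := (neg_le_abs _).trans_eq (by rw [abs_mul, hy, one_mul])
  linarith

lemma hinge_integral_le {α : Type*} {mα : MeasurableSpace α} {ρ : Measure α}
    [IsProbabilityMeasure ρ] {f : α → ℝ} (hf : Integrable f ρ) (y : ℝ) :
    hinge y (∫ x, f x ∂ρ) ≤ ∫ x, hinge y (f x) ∂ρ := by
  have haff : Integrable (fun x => 1 - y * f x) ρ := by fun_prop
  refine max_le ?_ (integral_nonneg fun x => hinge_nonneg _ _)
  calc 1 - y * ∫ x, f x ∂ρ = ∫ x, (1 - y * f x) ∂ρ := by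
        rw [integral_sub (integrable_const 1) (hf.const_mul y), integral_const_mul]; simp
    _ ≤ ∫ x, hinge y (f x) ∂ρ := integral_mono haff haff.pos_part fun x => le_max_left _ _

lemma min_add_ite_le_hinge {p q : ℝ} (hp : 0 ≤ p) (hq : 0 ≤ q) (t : ℝ) :
    min p q + (if 0 ≤ t then q else p) ≤ p * hinge 1 t + q * hinge (-1) t := by
  have h₁ : p * max (1 - t) 0 ≤ p * hinge 1 t := by simp [hinge]
  have h₂ : q * max (1 + t) 0 ≤ q * hinge (-1) t := by simp [hinge]
  refine le_trans ?_ (add_le_add h₁ h₂)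
  have hp_le : min p q ≤ p := min_le_left _ _
  have hq_le : min p q ≤ q := min_le_right _ _
  have hminus := le_max_left (1 - t) 0
  have hplus := le_max_left (1 + t) 0
  have hminus' := le_max_right (1 - t) 0
  have hplus' := le_max_right (1 + t) 0
  have hmin : 0 ≤ min p q := le_min hp hq
  split_ifs <;> nlinarith

end Hinge

section Risks

variable {d1 d2 n : ℕ}

lemma hinge_le_of_eq_one_or_eq_neg_one {B s : ℝ} (hB : 2 ≤ B) (hs : s = 1 ∨ s = -1) (y : Bool) :
    hinge (labelVal y) s ≤ B := by
  refine (hinge_le_one_add_abs (abs_labelVal y) s).trans ?_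
  rcases hs with rfl | rfl <;> norm_num <;> linarith

lemma hingeRisk_eq_sum (P : Measure (Obs d1 d2)) [IsFiniteMeasure P]
    (M : Matrix (Fin d1) (Fin d2) ℝ) :
    hingeRisk P M =
      ∑ x : Cell d1 d2, ∑ y, P.real {(x, y)} * hinge (labelVal y) (M x.1 x.2) := by
  rw [hingeRisk, integral_fintype .of_finite, Fintype.sum_prod_type]
  rfl

lemma hingeRisk_nonneg (P : Measure (Obs d1 d2)) (M : Matrix (Fin d1) (Fin d2) ℝ) :
    0 ≤ hingeRisk P M := integral_nonneg fun _ => hinge_nonneg _ _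

lemma hingeRisk_le (P : Measure (Obs d1 d2)) [IsProbabilityMeasure P]
    {M : Matrix (Fin d1) (Fin d2) ℝ} {B : ℝ} (hM : ∀ i j y, hinge (labelVal y) (M i j) ≤ B) :
    hingeRisk P M ≤ B := by
  simpa [hingeRisk] using integral_mono (μ := P) .of_finite (integrable_const B)
    fun z => hM z.1.1 z.1.2 z.2

lemma hingeRisk_sub_hingeRisk (P : Measure (Obs d1 d2)) [IsFiniteMeasure P]
    (M M' : Matrix (Fin d1) (Fin d2) ℝ) :
    hingeRisk P M - hingeRisk P M' =
      ∫ z, (hinge (labelVal z.2) (M z.1.1 z.1.2) - hinge (labelVal z.2) (M' z.1.1 z.1.2)) ∂P :=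
  (integral_sub .of_finite .of_finite).symm

lemma empHingeRisk_nonneg (D : Fin n → Obs d1 d2) (M : Matrix (Fin d1) (Fin d2) ℝ) :
    0 ≤ empHingeRisk D M :=
  mul_nonneg (by positivity) (Finset.sum_nonneg fun _ _ => hinge_nonneg _ _)

lemma empHingeRisk_sub_empHingeRisk (D : Fin n → Obs d1 d2) (M M' : Matrix (Fin d1) (Fin d2) ℝ) :
    empHingeRisk D M - empHingeRisk D M' = 1 / (n : ℝ) *
      ∑ k, (hinge (labelVal (D k).2) (M (D k).1.1 (D k).1.2) -
        hinge (labelVal (D k).2) (M' (D k).1.1 (D k).1.2)) := by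
  rw [empHingeRisk, empHingeRisk, ← mul_sub, Finset.sum_sub_distrib]

lemma mean_le_of_forall_le {u : Fin n → ℝ} {δ : ℝ} (hδ : 0 ≤ δ) (hu : ∀ k, u k ≤ δ) :
    1 / (n : ℝ) * ∑ k, u k ≤ δ := by
  rw [one_div_mul_eq_div]
  exact div_le_of_le_mul₀ n.cast_nonneg hδ <|
    (Finset.sum_le_card_nsmul _ _ δ fun k _ => hu k).trans_eq (by simp [mul_comm])

lemma empHingeRisk_le {B : ℝ} (hB : 0 ≤ B) (D : Fin n → Obs d1 d2)
    {M : Matrix (Fin d1) (Fin d2) ℝ} (hM : ∀ i j y, hinge (labelVal y) (M i j) ≤ B) :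
    empHingeRisk D M ≤ B :=
  mean_le_of_forall_le hB fun _ => hM _ _ _

lemma empHingeRisk_sub_empHingeRisk_le {δ : ℝ} (hδ : 0 ≤ δ) (D : Fin n → Obs d1 d2)
    {M M' : Matrix (Fin d1) (Fin d2) ℝ} (h : ∀ i j, |M i j - M' i j| ≤ δ) :
    empHingeRisk D M - empHingeRisk D M' ≤ δ := by
  rw [empHingeRisk_sub_empHingeRisk]
  refine mean_le_of_forall_le hδ fun k => (le_abs_self _).trans ?_
  simpa only [abs_labelVal, one_mul] using (abs_hinge_sub_hinge_le _ _ _).trans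
    (mul_le_mul_of_nonneg_left (h (D k).1.1 (D k).1.2) (abs_nonneg (labelVal (D k).2)))

lemma measureReal_ne_eq_sum (P : Measure (Obs d1 d2)) [IsFiniteMeasure P]
    (f : Cell d1 d2 → Bool) :
    P.real {z | z.2 ≠ f z.1} = ∑ x, if f x then P.real {(x, false)} else P.real {(x, true)} := by
  classical
  rw [← integral_indicator_one (Set.toFinite _).measurableSet, integral_fintype .of_finite,
    Fintype.sum_prod_type]
  refine Finset.sum_congr rfl fun x _ => ?_
  rw [Fintype.sum_bool]
  cases h : f x <;> simp [Set.indicator, h]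

lemma misclassRisk_eq_sum (P : Measure (Obs d1 d2)) [IsFiniteMeasure P]
    (M : Matrix (Fin d1) (Fin d2) ℝ) :
    misclassRisk P M = ∑ x : Cell d1 d2,
      if 0 ≤ M x.1 x.2 then P.real {(x, false)} else P.real {(x, true)} := by
  simpa [misclassRisk, sgn] using measureReal_ne_eq_sum P fun x => sgn (M x.1 x.2)

lemma misclassRisk_nonneg (P : Measure (Obs d1 d2)) (M : Matrix (Fin d1) (Fin d2) ℝ) :
    0 ≤ misclassRisk P M := measureReal_nonneg

lemma misclassRisk_le_one (P : Measure (Obs d1 d2)) [IsProbabilityMeasure P]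
    (M : Matrix (Fin d1) (Fin d2) ℝ) : misclassRisk P M ≤ 1 := measureReal_le_one

lemma bayesRisk_nonneg (P : Measure (Obs d1 d2)) : 0 ≤ bayesRisk P :=
  Real.iInf_nonneg fun _ => measureReal_nonneg

lemma sum_min_le_bayesRisk (P : Measure (Obs d1 d2)) [IsFiniteMeasure P] :
    ∑ x, min (P.real {(x, true)}) (P.real {(x, false)}) ≤ bayesRisk P := by
  refine le_ciInf fun f => ?_
  rw [measureReal_ne_eq_sum P f]
  refine Finset.sum_le_sum fun x _ => ?_
  split_ifs
  · exact min_le_right _ _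
  · exact min_le_left _ _

lemma sum_min_add_misclassRisk_le_hingeRisk (P : Measure (Obs d1 d2)) [IsFiniteMeasure P]
    (M : Matrix (Fin d1) (Fin d2) ℝ) :
    ∑ x, min (P.real {(x, true)}) (P.real {(x, false)}) + misclassRisk P M ≤ hingeRisk P M := by
  rw [misclassRisk_eq_sum, hingeRisk_eq_sum, ← Finset.sum_add_distrib]
  refine Finset.sum_le_sum fun x _ => ?_
  simpa [labelVal] using
    min_add_ite_le_hinge (p := P.real {(x, true)}) (q := P.real {(x, false)})
      measureReal_nonneg measureReal_nonneg (M x.1 x.2)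

lemma IsBayesMatrix.apply_eq_and_le {P : Measure (Obs d1 d2)} [IsFiniteMeasure P]
    {M : Matrix (Fin d1) (Fin d2) ℝ} (hM : IsBayesMatrix P M) (x : Cell d1 d2) :
    (M x.1 x.2 = 1 ∧ P.real {(x, false)} ≤ P.real {(x, true)}) ∨
      (M x.1 x.2 = -1 ∧ P.real {(x, true)} ≤ P.real {(x, false)}) := by
  obtain ⟨hsign, hpos, hneg⟩ := hM x.1 x.2
  have hmono (y : Bool) : P.real {(x, y)} ≤ P.real {z | z.1 = x} := measureReal_mono (by simp)
  rcases (measureReal_nonneg (μ := P) (s := {z | z.1 = x})).eq_or_lt with hx | hx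
  · have hzero (y : Bool) : P.real {(x, y)} = 0 :=
      le_antisymm ((hmono y).trans hx.ge) measureReal_nonneg
    simpa [hzero] using hsign
  · rcases lt_trichotomy (P.real {(x, true)}) (P.real {(x, false)}) with h | h | h
    · exact Or.inr ⟨hneg (div_neg_of_neg_of_pos (sub_neg.mpr h) hx), h.le⟩
    · exact hsign.imp (⟨·, h.ge⟩) (⟨·, h.le⟩)
    · exact Or.inl ⟨hpos (div_pos (sub_pos.mpr h) hx), h.le⟩

lemma IsBayesMatrix.hingeRisk_eq {P : Measure (Obs d1 d2)} [IsFiniteMeasure P]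
    {M : Matrix (Fin d1) (Fin d2) ℝ} (hM : IsBayesMatrix P M) :
    hingeRisk P M = 2 * ∑ x, min (P.real {(x, true)}) (P.real {(x, false)}) := by
  rw [hingeRisk_eq_sum, Finset.mul_sum]
  refine Finset.sum_congr rfl fun x _ => ?_
  rcases hM.apply_eq_and_le x with ⟨hx, hle⟩ | ⟨hx, hle⟩ <;>
    simp [hx, hle, hinge, labelVal] <;> norm_num [mul_comm]

lemma misclassRisk_sub_bayesRisk_le (P : Measure (Obs d1 d2)) [IsFiniteMeasure P]
    {Ms : Matrix (Fin d1) (Fin d2) ℝ} (hMs : IsBayesMatrix P Ms)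
    (M : Matrix (Fin d1) (Fin d2) ℝ) :
    misclassRisk P M - bayesRisk P ≤ hingeRisk P M - hingeRisk P Ms := by
  linarith [sum_min_le_bayesRisk P, sum_min_add_misclassRisk_le_hingeRisk P M, hMs.hingeRisk_eq]

end Risks

section Parameters

variable {d1 d2 m n : ℕ}

lemma toMatrix_apply (θ : Params d1 d2 m) (i : Fin d1) (j : Fin d2) :
    toMatrix θ i j = ∑ k, θ.1 i k * θ.2.1 j k := by
  simp [toMatrix, Matrix.mul_apply]

@[fun_prop]
lemma measurable_toMatrix_apply (i : Fin d1) (j : Fin d2) :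
    Measurable fun θ : Params d1 d2 m => toMatrix θ i j := by
  simp only [toMatrix_apply]
  fun_prop

@[fun_prop]
lemma measurable_empHingeRisk_toMatrix (D : Fin n → Obs d1 d2) :
    Measurable fun θ : Params d1 d2 m => empHingeRisk D (toMatrix θ) := by
  unfold empHingeRisk
  fun_prop

@[fun_prop]
lemma measurable_hingeRisk_toMatrix (P : Measure (Obs d1 d2)) [IsFiniteMeasure P] :
    Measurable fun θ : Params d1 d2 m => hingeRisk P (toMatrix θ) := by
  simp only [hingeRisk_eq_sum]
  fun_prop

@[fun_prop]
lemma measurable_misclassRisk_toMatrix (P : Measure (Obs d1 d2)) [IsFiniteMeasure P] :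
    Measurable fun θ : Params d1 d2 m => misclassRisk P (toMatrix θ) := by
  simp only [misclassRisk_eq_sum]
  exact Finset.measurable_fun_sum _ fun x _ => Measurable.ite
    (measurableSet_le measurable_const (by fun_prop)) measurable_const measurable_const

lemma measurableSet_paramSet (B : ℝ) : MeasurableSet (paramSet d1 d2 m B) := by
  unfold paramSet
  simp only [Set.ofPred_forall]
  exact .iInter fun i => .iInter fun j => .iInter fun y =>
    measurableSet_le (by fun_prop) measurable_const

lemma mem_paramSet_of_abs_le {B : ℝ} {θ : Params d1 d2 m}
    (hθ : ∀ i j, |toMatrix θ i j| ≤ B - 1) : θ ∈ paramSet d1 d2 m B := fun i j y => by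
  linarith [hinge_le_one_add_abs (abs_labelVal y) (toMatrix θ i j), hθ i j]

lemma abs_toMatrix_le {B : ℝ} {θ : Params d1 d2 m} (hθ : θ ∈ paramSet d1 d2 m B)
    (i : Fin d1) (j : Fin d2) : |toMatrix θ i j| ≤ B - 1 := by
  have htrue : 1 - toMatrix θ i j ≤ B := by
    simpa [labelVal] using (le_max_left _ _).trans (hθ i j true)
  have hfalse : 1 + toMatrix θ i j ≤ B := by
    simpa [labelVal] using (le_max_left _ _).trans (hθ i j false)
  exact abs_le.mpr ⟨by linarith, by linarith⟩

lemma hingeRisk_meanMatrix_le (P : Measure (Obs d1 d2)) [IsFiniteMeasure P]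
    (ρ : Measure (Params d1 d2 m)) [IsProbabilityMeasure ρ]
    (hint : ∀ i j, Integrable (fun θ => toMatrix θ i j) ρ) :
    hingeRisk P (meanMatrix ρ) ≤ ∫ θ, hingeRisk P (toMatrix θ) ∂ρ := by
  have hhinge (x : Cell d1 d2) (y : Bool) :
      Integrable (fun θ => P.real {(x, y)} * hinge (labelVal y) (toMatrix θ x.1 x.2)) ρ :=
    (((integrable_const 1).sub ((hint _ _).const_mul _)).pos_part).const_mul _
  simp only [hingeRisk_eq_sum]
  rw [integral_finsetSum _ fun x _ => integrable_finsetSum _ fun y _ => hhinge x y]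
  refine Finset.sum_le_sum fun x _ => ?_
  rw [integral_finsetSum _ fun y _ => hhinge x y]
  refine Finset.sum_le_sum fun y _ => ?_
  rw [integral_const_mul]
  exact mul_le_mul_of_nonneg_left (hinge_integral_le (hint _ _) _) measureReal_nonneg

end Parameters

section Bernstein

variable {Ω : Type*} {mΩ : MeasurableSpace Ω} {P : Measure Ω} [IsProbabilityMeasure P]
  {l : Ω → ℝ} {t b K : ℝ}

lemma integral_exp_neg_mul_le_of_bernstein (hl : AEStronglyMeasurable l P)
    (hlb : ∀ᵐ z ∂P, |l z| ≤ b) (ht : 0 ≤ t) (htb : t * b ≤ 1) (hK : 0 < K) (htK : t * K ≤ 1 / 2)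
    (hvar : ∫ z, l z ^ 2 ∂P ≤ K * ∫ z, l z ∂P) :
    ∫ z, Real.exp (-(t * l z)) ∂P ≤ Real.exp (-(t / 2 * ∫ z, l z ∂P)) := by
  have hl_int : Integrable l P := .of_bound hl b hlb
  have hlsq_int : Integrable (fun z => l z ^ 2) P := by
    refine .of_bound (hl.pow 2) (b ^ 2) ?_
    filter_upwards [hlb] with z hz
    rw [norm_pow, Real.norm_eq_abs]
    gcongr
  have htl : ∀ᵐ z ∂P, |-(t * l z)| ≤ 1 := by
    filter_upwards [hlb] with z hz
    rw [abs_neg, abs_mul, abs_of_nonneg ht]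
    exact (mul_le_mul_of_nonneg_left hz ht).trans htb
  have hmean : 0 ≤ ∫ z, l z ∂P :=
    nonneg_of_mul_nonneg_right ((integral_nonneg fun z => sq_nonneg (l z)).trans hvar) hK
  calc ∫ z, Real.exp (-(t * l z)) ∂P ≤ ∫ z, (1 - t * l z + t ^ 2 * l z ^ 2) ∂P := by
        refine integral_mono_ae (integrable_exp_of_abs_le (by fun_prop) htl) (by fun_prop) ?_
        filter_upwards [htl] with z hz
        linarith [(abs_le.mp (Real.abs_exp_sub_one_sub_id_le hz)).2]
    _ = 1 - t * ∫ z, l z ∂P + t ^ 2 * ∫ z, l z ^ 2 ∂P := by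
        rw [integral_add (by fun_prop) (by fun_prop), integral_sub (by fun_prop) (by fun_prop),
          integral_const_mul, integral_const_mul]
        simp
    _ ≤ 1 - t * ∫ z, l z ∂P + 1 / 2 * (t * ∫ z, l z ∂P) := by
        have hquad : t ^ 2 * ∫ z, l z ^ 2 ∂P ≤ t ^ 2 * (K * ∫ z, l z ∂P) := by gcongr
        have hlin : t * K * (t * ∫ z, l z ∂P) ≤ 1 / 2 * (t * ∫ z, l z ∂P) := by gcongr
        linarith
    _ = -(t / 2 * ∫ z, l z ∂P) + 1 := by ring
    _ ≤ Real.exp (-(t / 2 * ∫ z, l z ∂P)) := Real.add_one_le_exp _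

lemma integral_pi_exp_le_one_of_bernstein (n : ℕ) (hl : AEStronglyMeasurable l P)
    (hlb : ∀ᵐ z ∂P, |l z| ≤ b) (ht : 0 ≤ t) (htb : t * b ≤ 1) (hK : 0 < K) (htK : t * K ≤ 1 / 2)
    (hvar : ∫ z, l z ^ 2 ∂P ≤ K * ∫ z, l z ∂P) :
    ∫ D, Real.exp (n * (t / 2 * ∫ z, l z ∂P) - t * ∑ k, l (D k))
      ∂(Measure.pi fun _ : Fin n => P) ≤ 1 := by
  set μ := t / 2 * ∫ z, l z ∂P
  calc ∫ D, Real.exp (n * μ - t * ∑ k, l (D k)) ∂(Measure.pi fun _ : Fin n => P)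
      = ∫ D, Real.exp (n * μ) * ∏ k, Real.exp (-(t * l (D k)))
          ∂(Measure.pi fun _ : Fin n => P) := by
        refine integral_congr_ae (.of_forall fun D => ?_)
        simp only
        rw [← Real.exp_sum, ← Real.exp_add, Finset.sum_neg_distrib, ← Finset.mul_sum,
          ← sub_eq_add_neg]
    _ = Real.exp (n * μ) * (∫ z, Real.exp (-(t * l z)) ∂P) ^ n := by
        rw [integral_const_mul,
          integral_fintype_prod_eq_prod fun (_ : Fin n) z => Real.exp (-(t * l z)),
          Finset.prod_const, Finset.card_fin]
    _ ≤ Real.exp (n * μ) * Real.exp (-μ) ^ n := by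
        gcongr
        exact integral_exp_neg_mul_le_of_bernstein hl hlb ht htb hK htK hvar
    _ = 1 := by rw [← Real.exp_nat_mul, ← Real.exp_add]; simp

end Bernstein

section OracleInequality

open InformationTheory

variable {d1 d2 m n : ℕ} {P : Measure (Obs d1 d2)} [IsProbabilityMeasure P]
  {Ms : Matrix (Fin d1) (Fin d2) ℝ} {K B lam : ℝ}

lemma integral_exp_excess_le_one {M : Matrix (Fin d1) (Fin d2) ℝ}
    (hM : ∀ i j y, hinge (labelVal y) (M i j) ≤ B)
    (hMs : ∀ i j y, hinge (labelVal y) (Ms i j) ≤ B) (hK : 0 < K)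
    (hbern : sqDist P M Ms ≤ K * (hingeRisk P M - hingeRisk P Ms))
    (hlam : 0 < lam) (hlamK : lam * (2 * K) ≤ n) (hlamB : lam * B ≤ n) :
    ∫ D, Real.exp (lam / 2 * (hingeRisk P M - hingeRisk P Ms) -
      lam * (empHingeRisk D M - empHingeRisk D Ms)) ∂(Measure.pi fun _ : Fin n => P) ≤ 1 := by
  have hn : (0 : ℝ) < n := lt_of_lt_of_le (by positivity) hlamK
  set l : Obs d1 d2 → ℝ := fun z =>
    hinge (labelVal z.2) (M z.1.1 z.1.2) - hinge (labelVal z.2) (Ms z.1.1 z.1.2) with hl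
  have hlB (z : Obs d1 d2) : |l z| ≤ B := by
    rw [← sub_zero B]
    exact abs_sub_le_of_le_of_le (hinge_nonneg _ _) (hM _ _ _) (hinge_nonneg _ _) (hMs _ _ _)
  have hvar : ∫ z, l z ^ 2 ∂P ≤ K * ∫ z, l z ∂P := by
    rw [hl, ← hingeRisk_sub_hingeRisk]
    refine le_trans (integral_mono .of_finite .of_finite fun z => ?_) hbern
    refine sq_le_sq.mpr ?_
    simpa only [abs_labelVal, one_mul] using
      abs_hinge_sub_hinge_le (labelVal z.2) (M z.1.1 z.1.2) (Ms z.1.1 z.1.2)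
  have hmoment := integral_pi_exp_le_one_of_bernstein (t := lam / n) n
    (Measurable.of_discrete.aestronglyMeasurable) (.of_forall hlB) (by positivity)
    (by rwa [div_mul_eq_mul_div, div_le_one hn]) hK
    (by rw [div_mul_eq_mul_div, div_le_iff₀ hn]; linarith) hvar
  refine le_of_eq_of_le (integral_congr_ae (.of_forall fun D => ?_)) hmoment
  simp only [hingeRisk_sub_hingeRisk, empHingeRisk_sub_empHingeRisk, hl]
  congr 1
  field_simp

lemma tilted_add_const {α : Type*} {mα : MeasurableSpace α} (π : Measure α)
    [IsProbabilityMeasure π] (f : α → ℝ) (c : ℝ) : (π.tilted fun x => f x + c) = π.tilted f := by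
  have h := tilted_tilted (μ := π) (integrable_const (Real.exp c)) f
  rw [tilted_const] at h
  rw [h]
  congr! 1
  ext x
  simp [add_comm]

lemma gibbs_eq_tilted_excess (π : Measure (Params d1 d2 m)) [IsProbabilityMeasure π] (lam : ℝ)
    (D : Fin n → Obs d1 d2) (M : Matrix (Fin d1) (Fin d2) ℝ) :
    gibbs π lam D =
      π.tilted (-fun θ => lam * (empHingeRisk D (toMatrix θ) - empHingeRisk D M)) := by
  rw [gibbs, ← tilted_add_const π _ (lam * empHingeRisk D M)]
  congr! 1
  ext θ
  simp only [Pi.neg_apply]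
  ring

lemma integral_excess_le_of_klDiv_gibbs_le {c δ : ℝ} (hK : 0 < K) (hB : 2 ≤ B) (hlam : 0 < lam)
    (hlamK : lam * (2 * K) ≤ n) (hlamB : lam * B ≤ n)
    (hMs : ∀ i j, Ms i j = 1 ∨ Ms i j = -1)
    (hbern : ∀ θ ∈ paramSet d1 d2 m B, sqDist P (toMatrix θ) Ms ≤
      K * (hingeRisk P (toMatrix θ) - hingeRisk P Ms))
    {π ρ' : Measure (Params d1 d2 m)} [IsProbabilityMeasure π] [IsProbabilityMeasure ρ']
    (hπ : ∀ᵐ θ ∂π, θ ∈ paramSet d1 d2 m B) (hρ' : klDiv ρ' π ≤ ENNReal.ofReal c) (hc : 0 ≤ c)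
    (hδ : 0 ≤ δ) (hρ'δ : ∀ᵐ θ ∂ρ', ∀ i j, |toMatrix θ i j - Ms i j| ≤ δ)
    {ρ : (Fin n → Obs d1 d2) → Measure (Params d1 d2 m)} [∀ D, IsProbabilityMeasure (ρ D)]
    (hkl : ∀ D, klDiv (ρ D) (gibbs π lam D) ≤ klDiv ρ' (gibbs π lam D)) :
    ∫ D, (∫ θ, (hingeRisk P (toMatrix θ) - hingeRisk P Ms) ∂(ρ D))
        ∂(Measure.pi fun _ : Fin n => P) ≤ 2 * (c / lam + δ) := by
  have hMsB (i j y) : hinge (labelVal y) (Ms i j) ≤ B :=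
    hinge_le_of_eq_one_or_eq_neg_one hB (hMs i j) y
  have hexcess : ∀ᵐ θ ∂π, |lam / 2 * (hingeRisk P (toMatrix θ) - hingeRisk P Ms)| ≤
      lam / 2 * B := by
    filter_upwards [hπ] with θ hθ
    rw [abs_mul, abs_of_pos (half_pos hlam), ← sub_zero B]
    gcongr
    exact abs_sub_le_of_le_of_le (hingeRisk_nonneg _ _) (hingeRisk_le P hθ)
      (hingeRisk_nonneg _ _) (hingeRisk_le P hMsB)
  have hempExcess (D : Fin n → Obs d1 d2) : ∀ᵐ θ ∂π,
      |lam * (empHingeRisk D (toMatrix θ) - empHingeRisk D Ms)| ≤ lam * B := by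
    filter_upwards [hπ] with θ hθ
    have hB0 : 0 ≤ B := by linarith
    rw [abs_mul, abs_of_pos hlam, ← sub_zero B]
    gcongr
    exact abs_sub_le_of_le_of_le (empHingeRisk_nonneg _ _) (empHingeRisk_le hB0 D hθ)
      (empHingeRisk_nonneg _ _) (empHingeRisk_le hB0 D hMsB)
  have hPAC := integral_integral_le_of_klDiv_tilted_le (ν := Measure.pi fun _ : Fin n => P)
    (f := fun D θ => lam * (empHingeRisk D (toMatrix θ) - empHingeRisk D Ms)) (b := lam * δ)
    (by fun_prop) (by fun_prop) hempExcess hexcess hρ' hc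
    (fun D => hρ'δ.mono fun θ hθ => mul_le_mul_of_nonneg_left
      (empHingeRisk_sub_empHingeRisk_le hδ D hθ) hlam.le)
    (fun D => by simpa only [← gibbs_eq_tilted_excess] using hkl D)
    (hπ.mono fun θ hθ => integral_exp_excess_le_one hθ hMsB hK (hbern θ hθ) hlam hlamK hlamB)
  simp only [integral_const_mul] at hPAC
  calc _ = 2 / lam * (lam / 2 * ∫ D, (∫ θ, (hingeRisk P (toMatrix θ) - hingeRisk P Ms) ∂(ρ D))
        ∂(Measure.pi fun _ : Fin n => P)) := by field_simp
    _ ≤ 2 / lam * (c + lam * δ) := by gcongr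
    _ = 2 * (c / lam + δ) := by field_simp

end OracleInequality

section Product

lemma lintegral_fin_prod_eq_prod {n : ℕ} {E : Fin n → Type*} {mE : ∀ i, MeasurableSpace (E i)}
    {μ : ∀ i, Measure (E i)} [∀ i, SigmaFinite (μ i)] {f : ∀ i, E i → ℝ≥0∞}
    (hf : ∀ i, Measurable (f i)) :
    ∫⁻ x, ∏ i, f i (x i) ∂(Measure.pi μ) = ∏ i, ∫⁻ x, f i x ∂(μ i) := by
  induction n with
  | zero => simp
  | succ n ih =>
    have htail : Measurable fun x : ∀ i : Fin n, E i.succ => ∏ i, f (Fin.succ i) (x i) :=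
      Finset.measurable_fun_prod _ fun i _ => (hf i.succ).comp (measurable_pi_apply i)
    calc ∫⁻ x, ∏ i, f i (x i) ∂(Measure.pi μ)
        = ∫⁻ x : E 0 × (∀ i : Fin n, E i.succ), f 0 x.1 * ∏ i : Fin n, f (Fin.succ i) (x.2 i)
            ∂((μ 0).prod (Measure.pi fun i => μ i.succ)) :=
          (lintegral_congr fun x => Fin.prod_univ_succ _).trans
            ((measurePreserving_piFinSuccAbove μ 0).lintegral_comp
              (((hf 0).comp measurable_fst).mul (htail.comp measurable_snd)))
      _ = ∏ i, ∫⁻ x, f i x ∂(μ i) := by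
          rw [lintegral_prod_mul (hf 0).aemeasurable htail.aemeasurable, ih fun i => hf i.succ,
            Fin.prod_univ_succ]

variable {ι : Type*} [Fintype ι] {E : ι → Type*} {mE : ∀ i, MeasurableSpace (E i)}
  {μ : ∀ i, Measure (E i)} [∀ i, SigmaFinite (μ i)] {f : ∀ i, E i → ℝ≥0∞}

lemma lintegral_fintype_prod_eq_prod (hf : ∀ i, Measurable (f i)) :
    ∫⁻ x, ∏ i, f i (x i) ∂(Measure.pi μ) = ∏ i, ∫⁻ x, f i x ∂(μ i) := by
  let e := (Fintype.equivFin ι).symm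
  rw [← (measurePreserving_piCongrLeft _ e).lintegral_comp_emb
    (MeasurableEquiv.measurableEmbedding _)]
  simp_rw [← e.prod_comp, MeasurableEquiv.coe_piCongrLeft, Equiv.piCongrLeft_apply_apply]
  exact lintegral_fin_prod_eq_prod fun i => hf (e i)

lemma pi_withDensity (hf : ∀ i, Measurable (f i)) [∀ i, SigmaFinite ((μ i).withDensity (f i))] :
    Measure.pi (fun i => (μ i).withDensity (f i)) =
      (Measure.pi μ).withDensity fun x => ∏ i, f i (x i) := by
  classical
  refine Measure.pi_eq fun s hs => ?_
  have hind : (Set.univ.pi s).indicator (fun x => ∏ i, f i (x i)) =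
      fun x => ∏ i, (s i).indicator (f i) (x i) := by
    ext x
    by_cases hx : x ∈ Set.univ.pi s
    · rw [Set.indicator_of_mem hx]
      exact Finset.prod_congr rfl fun i _ => (Set.indicator_of_mem (hx i trivial) _).symm
    · rw [Set.indicator_of_notMem hx]
      simp only [Set.mem_univ_pi, not_forall] at hx
      obtain ⟨i, hi⟩ := hx
      exact (Finset.prod_eq_zero (Finset.mem_univ i) (Set.indicator_of_notMem hi _)).symm
  rw [withDensity_apply _ (MeasurableSet.univ_pi hs),
    ← lintegral_indicator (MeasurableSet.univ_pi hs), hind,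
    lintegral_fintype_prod_eq_prod fun i => (hf i).indicator (hs i)]
  exact Finset.prod_congr rfl fun i _ => by
    rw [lintegral_indicator (hs i), withDensity_apply _ (hs i)]

lemma isProbabilityMeasure_withDensity {α : Type*} [MeasurableSpace α] {μ : Measure α}
    {f : α → ℝ≥0∞} (hf : ∫⁻ x, f x ∂μ = 1) : IsProbabilityMeasure (μ.withDensity f) :=
  ⟨by rw [withDensity_apply _ MeasurableSet.univ, setLIntegral_univ, hf]⟩

lemma lintegral_mul_snd_le {α β : Type*} [MeasurableSpace α] [MeasurableSpace β] {μ : Measure α}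
    {ν : Measure β} [SFinite μ] [SFinite ν] {f : α × β → ℝ≥0∞} {h : β → ℝ≥0∞}
    (hf : Measurable f) (hh : Measurable h) (hf1 : ∀ z, ∫⁻ x, f (x, z) ∂μ ≤ 1) :
    ∫⁻ w, f w * h w.2 ∂(μ.prod ν) ≤ ∫⁻ z, h z ∂ν := by
  rw [lintegral_prod_symm _ (by fun_prop)]
  refine lintegral_mono fun z => ?_
  exact (lintegral_mul_const (h z) (hf.comp measurable_prodMk_right)).trans_le
    (mul_le_of_le_one_left' (hf1 z))

end Product

section HierarchicalPrior

lemma lintegral_invGammaPDF_eq_lintegral_gammaPDF (a b : ℝ) :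
    ∫⁻ x, invGammaPDF a b x = ∫⁻ x in Set.Ioi 0, gammaPDF a b x := by
  have hsub := lintegral_image_eq_lintegral_abs_deriv_mul (s := Set.Ioi (0 : ℝ))
    measurableSet_Ioi (f := fun x => x⁻¹) (f' := fun x => -(x ^ 2)⁻¹)
    (fun x hx => (hasDerivAt_inv (ne_of_gt hx)).hasDerivWithinAt)
    inv_injective.injOn (gammaPDF a b)
  have himage : (fun x : ℝ => x⁻¹) '' Set.Ioi 0 = Set.Ioi 0 := by
    ext x; simp
  have hsupport : Function.support (invGammaPDF a b) ⊆ Set.Ioi 0 := fun x hx => by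
    by_contra hneg
    exact hx (by simp [invGammaPDF, show ¬ 0 < x from hneg])
  rw [himage] at hsub
  rw [hsub, ← setLIntegral_eq_of_support_subset hsupport]
  refine setLIntegral_congr_fun measurableSet_Ioi fun x (hx : 0 < x) => ?_
  have hpow : x ^ (-a - 1) = x ^ (-((2 : ℕ) : ℝ)) * x ^ (-(a - 1)) := by
    rw [← Real.rpow_add hx]; congr 1; push_cast; ring
  simp only [invGammaPDF, if_pos hx]
  rw [gammaPDF_of_nonneg (inv_pos.mpr hx).le, ← ENNReal.ofReal_mul (abs_nonneg _), abs_neg,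
    abs_of_pos (by positivity), Real.inv_rpow hx.le, ← Real.rpow_neg hx.le,
    ← Real.rpow_natCast, ← Real.rpow_neg hx.le, ← div_eq_mul_inv, hpow]
  congr 1
  ring

variable (fam : VarianceFamily) {a b B : ℝ} {d1 d2 m : ℕ}

@[fun_prop]
lemma measurable_variancePDF (a b : ℝ) : Measurable (variancePDF fam a b) := by
  cases fam
  · exact ENNReal.measurable_ofReal.comp (measurable_gammaPDFReal a b)
  · exact ENNReal.measurable_ofReal.comp
      (Measurable.ite measurableSet_Ioi (by fun_prop) measurable_const)

lemma variancePDF_pos (ha : 0 < a) (hb : 0 < b) {x : ℝ} (hx : 0 < x) :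
    0 < variancePDF fam a b x := by
  have := Real.Gamma_pos_of_pos ha
  cases fam
  · exact ENNReal.ofReal_pos.mpr (gammaPDFReal_pos ha hb hx)
  · exact ENNReal.ofReal_pos.mpr (by rw [if_pos hx]; positivity)

lemma lintegral_variancePDF_le_one (ha : 0 < a) (hb : 0 < b) :
    ∫⁻ x, variancePDF fam a b x ≤ 1 := by
  cases fam
  · exact (lintegral_gammaPDF_eq_one ha hb).le
  · exact (lintegral_invGammaPDF_eq_lintegral_gammaPDF a b).trans_le
      ((setLIntegral_le_lintegral _ _).trans (lintegral_gammaPDF_eq_one ha hb).le)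

lemma lintegral_gaussianPDF_le_one (μ : ℝ) (v : NNReal) : ∫⁻ x, gaussianPDF μ v x ≤ 1 := by
  by_cases hv : v = 0
  · simp [hv]
  · exact (lintegral_gaussianPDF_eq_one μ hv).le

lemma lintegral_gaussianArray_le_one (d : ℕ) (v : Fin m → NNReal) :
    ∫⁻ L : Fin d → Fin m → ℝ, ∏ k, ∏ i, gaussianPDF 0 (v k) (L i k) ≤ 1 := by
  have hm : Measurable fun l : Fin m → ℝ => ∏ k, gaussianPDF 0 (v k) (l k) :=
    Finset.measurable_fun_prod _ fun k _ =>
      (measurable_gaussianPDF _ _).comp (measurable_pi_apply k)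
  calc ∫⁻ L : Fin d → Fin m → ℝ, ∏ k, ∏ i, gaussianPDF 0 (v k) (L i k)
      = ∫⁻ L : Fin d → Fin m → ℝ, ∏ i, ∏ k, gaussianPDF 0 (v k) (L i k) :=
        lintegral_congr fun L => Finset.prod_comm
    _ = ∏ _i : Fin d, ∏ k, ∫⁻ x, gaussianPDF 0 (v k) x := by
        rw [volume_pi, lintegral_fintype_prod_eq_prod fun _ => hm]
        refine Finset.prod_congr rfl fun i _ => ?_
        rw [volume_pi, lintegral_fintype_prod_eq_prod fun k => measurable_gaussianPDF _ _]
    _ ≤ 1 := Finset.prod_le_one' fun i _ => Finset.prod_le_one' fun k _ =>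
        lintegral_gaussianPDF_le_one _ _

@[fun_prop]
lemma measurable_gaussianPDF_toNNReal {α : Type*} [MeasurableSpace α] {v x : α → ℝ}
    (hv : Measurable v) (hx : Measurable x) :
    Measurable fun t => gaussianPDF 0 (v t).toNNReal (x t) :=
  measurable_uncurry_gaussianPDF.comp
    (measurable_const.prodMk (hv.real_toNNReal.prodMk hx))

lemma hierarchicalPrior_univ_le_one (ha : 0 < a) (hb : 0 < b) :
    hierarchicalPrior d1 d2 m fam a b Set.univ ≤ 1 := by
  let pL : Params d1 d2 m → ℝ≥0∞ := fun θ =>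
    ∏ k, ∏ i, gaussianPDF 0 (θ.2.2 k).toNNReal (θ.1 i k)
  let pR : (Fin d2 → Fin m → ℝ) × (Fin m → ℝ) → ℝ≥0∞ := fun z =>
    ∏ k, ∏ j, gaussianPDF 0 (z.2 k).toNNReal (z.1 j k)
  let pγ : (Fin m → ℝ) → ℝ≥0∞ := fun γ => ∏ k, variancePDF fam a b (γ k)
  have hpL : Measurable pL := by fun_prop
  have hpR : Measurable pR := by fun_prop
  have hpγ : Measurable pγ := by fun_prop
  rw [hierarchicalPrior, withDensity_apply _ MeasurableSet.univ, setLIntegral_univ]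
  calc _ = ∫⁻ θ : Params d1 d2 m, pL θ * (pR θ.2 * pγ θ.2.2) :=
        lintegral_congr fun θ => by
          simp only [pL, pR, pγ, ← Finset.prod_mul_distrib]
          exact Finset.prod_congr rfl fun k _ => by ring
    _ ≤ ∫⁻ z, pR z * pγ z.2 :=
        lintegral_mul_snd_le hpL (h := fun z => pR z * pγ z.2) (by fun_prop)
          fun z => lintegral_gaussianArray_le_one d1 fun k => (z.2 k).toNNReal
    _ ≤ ∫⁻ γ, pγ γ :=
        lintegral_mul_snd_le hpR hpγ fun γ =>
          lintegral_gaussianArray_le_one d2 fun k => (γ k).toNNReal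
    _ ≤ 1 := by
        rw [volume_pi, lintegral_fintype_prod_eq_prod fun _ => measurable_variancePDF fam a b]
        exact Finset.prod_le_one' fun k _ => lintegral_variancePDF_le_one fam ha hb

lemma hierarchicalPrior_paramSet_ne_zero (ha : 0 < a) (hb : 0 < b) (hB : 1 < B) :
    hierarchicalPrior d1 d2 m fam a b (paramSet d1 d2 m B) ≠ 0 := by
  set U : Set (Params d1 d2 m) := {θ | (∀ i j, |toMatrix θ i j| < B - 1) ∧ ∀ k, 0 < θ.2.2 k}
  have hUopen : IsOpen U := by
    simp only [U, toMatrix_apply, Set.ofPred_and, Set.ofPred_forall]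
    exact (isOpen_iInter_of_finite fun i => isOpen_iInter_of_finite fun j =>
      isOpen_lt (by fun_prop) continuous_const).inter
      (isOpen_iInter_of_finite fun k => isOpen_lt continuous_const (by fun_prop))
  have hUne : U.Nonempty := ⟨(0, 0, 1), fun i j => by simpa [toMatrix_apply] using hB, by simp⟩
  rw [hierarchicalPrior, Ne, withDensity_apply_eq_zero (by fun_prop)]
  have : (volume : Measure (Params d1 d2 m)).IsOpenPosMeasure := by
    have (d : ℕ) : (volume : Measure (Fin d → Fin m → ℝ)).IsOpenPosMeasure := by
      rw [volume_pi]; infer_instance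
    rw [Measure.volume_eq_prod, Measure.volume_eq_prod]
    infer_instance
  refine fun hnull => (hUopen.measure_pos volume hUne).ne' (measure_mono_null ?_ hnull)
  rintro θ ⟨hθ, hγ⟩
  refine ⟨Finset.prod_ne_zero_iff.mpr fun k _ => ?_,
    mem_paramSet_of_abs_le fun i j => (hθ i j).le⟩
  have hgauss (x : ℝ) : gaussianPDF 0 (θ.2.2 k).toNNReal x ≠ 0 :=
    (gaussianPDF_pos 0 (by simpa using hγ k) x).ne'
  exact mul_ne_zero (mul_ne_zero (variancePDF_pos fam ha hb (hγ k)).ne'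
    (Finset.prod_ne_zero_iff.mpr fun i _ => hgauss _))
    (Finset.prod_ne_zero_iff.mpr fun j _ => hgauss _)

lemma hierarchicalPrior_paramSet_le_one (ha : 0 < a) (hb : 0 < b) :
    hierarchicalPrior d1 d2 m fam a b (paramSet d1 d2 m B) ≤ 1 :=
  (measure_mono (Set.subset_univ _)).trans (hierarchicalPrior_univ_le_one fam ha hb)

lemma isProbabilityMeasure_prior (ha : 0 < a) (hb : 0 < b) (hB : 1 < B) :
    IsProbabilityMeasure (prior d1 d2 m fam a b B) :=
  cond_isProbabilityMeasure_of_finite (hierarchicalPrior_paramSet_ne_zero fam ha hb hB)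
    (ne_top_of_le_ne_top ENNReal.one_ne_top (hierarchicalPrior_paramSet_le_one fam ha hb))

lemma ae_mem_paramSet_prior : ∀ᵐ θ ∂(prior d1 d2 m fam a b B), θ ∈ paramSet d1 d2 m B :=
  ae_cond_mem (measurableSet_paramSet B)

lemma le_smul_prior (ha : 0 < a) (hb : 0 < b) {ρ : Measure (Params d1 d2 m)} {c : ℝ≥0∞}
    (hle : ρ ≤ c • hierarchicalPrior d1 d2 m fam a b) (hρ : ∀ᵐ θ ∂ρ, θ ∈ paramSet d1 d2 m B) :
    ρ ≤ c • prior d1 d2 m fam a b B := fun s => by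
  calc ρ s = ρ (paramSet d1 d2 m B ∩ s) :=
        (measure_congr (by filter_upwards [hρ] with θ hθ; exact propext (and_iff_right hθ))).symm
    _ ≤ c * hierarchicalPrior d1 d2 m fam a b (paramSet d1 d2 m B ∩ s) := hle _
    _ ≤ c * prior d1 d2 m fam a b B s := by
        rw [prior, cond_apply (measurableSet_paramSet B)]
        gcongr
        exact le_mul_of_one_le_left'
          (ENNReal.one_le_inv.mpr (hierarchicalPrior_paramSet_le_one fam ha hb))

end HierarchicalPrior

section Factorized

variable {d d1 d2 m : ℕ}

/-- The density, with respect to the Lebesgue measure, of the fully factorized law whose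
one-dimensional marginals have the densities `p` (entries of `L`), `q` (entries of `R`) and `g`
(variances). The product is arranged column by column, as in `hierarchicalPrior`. -/
noncomputable def productDensity (p : Fin d1 → Fin m → ℝ → ℝ≥0∞) (q : Fin d2 → Fin m → ℝ → ℝ≥0∞)
    (g : Fin m → ℝ → ℝ≥0∞) (θ : Params d1 d2 m) : ℝ≥0∞ :=
  ∏ k, (g k (θ.2.2 k) * (∏ i, p i k (θ.1 i k)) * (∏ j, q j k (θ.2.1 j k)))

variable {p : Fin d1 → Fin m → ℝ → ℝ≥0∞} {q : Fin d2 → Fin m → ℝ → ℝ≥0∞}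
  {g : Fin m → ℝ → ℝ≥0∞}

lemma measurable_prod_prod {p : Fin d → Fin m → ℝ → ℝ≥0∞} (hp : ∀ i k, Measurable (p i k)) :
    Measurable fun L : Fin d → Fin m → ℝ => ∏ k, ∏ i, p i k (L i k) := by
  fun_prop

lemma measurable_productDensity (hp : ∀ i k, Measurable (p i k)) (hq : ∀ j k, Measurable (q j k))
    (hg : ∀ k, Measurable (g k)) : Measurable (productDensity p q g) := by
  unfold productDensity
  fun_prop

lemma pi_pi_withDensity {p : Fin d → Fin m → ℝ → ℝ≥0∞} (hp : ∀ i k, Measurable (p i k))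
    (hp1 : ∀ i k, ∫⁻ x, p i k x = 1) :
    (Measure.pi fun i => Measure.pi fun k => volume.withDensity (p i k)) =
      (volume : Measure (Fin d → Fin m → ℝ)).withDensity fun L => ∏ k, ∏ i, p i k (L i k) := by
  have hprob (i k) : IsProbabilityMeasure (volume.withDensity (p i k)) :=
    isProbabilityMeasure_withDensity (hp1 i k)
  have hrow (i) : (Measure.pi fun k => volume.withDensity (p i k)) =
      (volume : Measure (Fin m → ℝ)).withDensity fun l => ∏ k, p i k (l k) := by
    rw [volume_pi]; exact pi_withDensity (hp i)
  have hrowprob (i) : IsProbabilityMeasure ((volume : Measure (Fin m → ℝ)).withDensity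
      fun l => ∏ k, p i k (l k)) := by
    rw [← hrow]; infer_instance
  simp only [hrow]
  rw [pi_withDensity fun i => by fun_prop, ← volume_pi]
  exact congrArg _ (funext fun L => Finset.prod_comm)

lemma withDensity_productDensity_eq (hp : ∀ i k, Measurable (p i k))
    (hq : ∀ j k, Measurable (q j k)) (hg : ∀ k, Measurable (g k))
    (hp1 : ∀ i k, ∫⁻ x, p i k x = 1) (hq1 : ∀ j k, ∫⁻ x, q j k x = 1)
    (hg1 : ∀ k, ∫⁻ x, g k x = 1) :
    (volume : Measure (Params d1 d2 m)).withDensity (productDensity p q g) =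
      (Measure.pi fun i => Measure.pi fun k => volume.withDensity (p i k)).prod
        ((Measure.pi fun j => Measure.pi fun k => volume.withDensity (q j k)).prod
          (Measure.pi fun k => volume.withDensity (g k))) := by
  have hgprob (k) : IsProbabilityMeasure (volume.withDensity (g k)) :=
    isProbabilityMeasure_withDensity (hg1 k)
  have hγ : Measurable fun γ : Fin m → ℝ => ∏ k, g k (γ k) := by fun_prop
  rw [pi_pi_withDensity hp hp1, pi_pi_withDensity hq hq1, pi_withDensity hg, ← volume_pi,
    prod_withDensity (measurable_prod_prod hq) hγ,
    prod_withDensity (measurable_prod_prod hp) (by fun_prop), ← Measure.volume_eq_prod,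
    ← Measure.volume_eq_prod]
  refine congrArg _ (funext fun θ => ?_)
  rw [productDensity, Finset.prod_mul_distrib, Finset.prod_mul_distrib]
  ring

lemma withDensity_productDensity_mem_fullyFactorized (hp : ∀ i k, Measurable (p i k))
    (hq : ∀ j k, Measurable (q j k)) (hg : ∀ k, Measurable (g k))
    (hp1 : ∀ i k, ∫⁻ x, p i k x = 1) (hq1 : ∀ j k, ∫⁻ x, q j k x = 1)
    (hg1 : ∀ k, ∫⁻ x, g k x = 1) :
    volume.withDensity (productDensity p q g) ∈ fullyFactorized d1 d2 m :=
  ⟨_, _, _, fun i k => isProbabilityMeasure_withDensity (hp1 i k),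
    fun j k => isProbabilityMeasure_withDensity (hq1 j k),
    fun k => isProbabilityMeasure_withDensity (hg1 k),
    withDensity_productDensity_eq hp hq hg hp1 hq1 hg1⟩

lemma isProbabilityMeasure_of_mem_fullyFactorized {ρ : Measure (Params d1 d2 m)}
    (hρ : ρ ∈ fullyFactorized d1 d2 m) : IsProbabilityMeasure ρ := by
  obtain ⟨p, q, g, hp, hq, hg, rfl⟩ := hρ
  infer_instance

lemma ae_ne_zero_withDensity_productDensity (hp : ∀ i k, Measurable (p i k))
    (hq : ∀ j k, Measurable (q j k)) (hg : ∀ k, Measurable (g k)) :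
    ∀ᵐ θ ∂(volume.withDensity (productDensity p q g)),
      (∀ i k, p i k (θ.1 i k) ≠ 0) ∧ ∀ j k, q j k (θ.2.1 j k) ≠ 0 := by
  rw [ae_withDensity_iff (measurable_productDensity hp hq hg)]
  refine .of_forall fun θ hθ => ?_
  simp only [productDensity, Finset.prod_ne_zero_iff, mul_ne_zero_iff, Finset.mem_univ,
    true_imp_iff] at hθ
  exact ⟨fun i k => (hθ k).1.2 i, fun j k => (hθ k).2 j⟩

lemma withDensity_productDensity_le_smul_hierarchicalPrior {fam : VarianceFamily} {a b : ℝ}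
    {cost : Fin m → ℝ}
    (hcol : ∀ k x (l : Fin d1 → ℝ) (r : Fin d2 → ℝ),
      g k x * (∏ i, p i k (l i)) * (∏ j, q j k (r j)) ≤ ENNReal.ofReal (Real.exp (cost k)) *
        (variancePDF fam a b x * (∏ i, gaussianPDF 0 x.toNNReal (l i)) *
          (∏ j, gaussianPDF 0 x.toNNReal (r j)))) :
    volume.withDensity (productDensity p q g) ≤
      ENNReal.ofReal (Real.exp (∑ k, cost k)) • hierarchicalPrior d1 d2 m fam a b := by
  rw [hierarchicalPrior, ← withDensity_smul' _ _ ENNReal.ofReal_ne_top]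
  refine withDensity_mono (.of_forall fun θ => ?_)
  rw [Pi.smul_apply, smul_eq_mul, Real.exp_sum,
    ENNReal.ofReal_prod_of_nonneg fun k _ => (Real.exp_pos _).le, ← Finset.prod_mul_distrib]
  exact Finset.prod_le_prod' fun k _ => hcol k (θ.2.2 k) (fun i => θ.1 i k) fun j => θ.2.1 j k

lemma prod_le_ofReal_exp_mul_prod {c : ℝ} {f h : Fin d → ℝ → ℝ≥0∞}
    (hfh : ∀ i y, f i y ≤ ENNReal.ofReal (Real.exp c) * h i y) (l : Fin d → ℝ) :
    ∏ i, f i (l i) ≤ ENNReal.ofReal (Real.exp (d * c)) * ∏ i, h i (l i) := by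
  calc ∏ i, f i (l i) ≤ ∏ i, (ENNReal.ofReal (Real.exp c) * h i (l i)) :=
        Finset.prod_le_prod' fun i _ => hfh i (l i)
    _ = ENNReal.ofReal (Real.exp (d * c)) * ∏ i, h i (l i) := by
        rw [Finset.prod_mul_distrib, Finset.prod_const, Finset.card_univ, Fintype.card_fin,
          Real.exp_nat_mul, ENNReal.ofReal_pow (Real.exp_pos c).le]

lemma column_le {fam : VarianceFamily} {a b c₀ c₁ x : ℝ} {g : ℝ → ℝ≥0∞}
    {p : Fin d1 → ℝ → ℝ≥0∞} {q : Fin d2 → ℝ → ℝ≥0∞}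
    (hg : g x ≠ 0 → g x ≤ ENNReal.ofReal (Real.exp c₀) * variancePDF fam a b x)
    (hp : g x ≠ 0 → ∀ i y, p i y ≤ ENNReal.ofReal (Real.exp c₁) * gaussianPDF 0 x.toNNReal y)
    (hq : g x ≠ 0 → ∀ j y, q j y ≤ ENNReal.ofReal (Real.exp c₁) * gaussianPDF 0 x.toNNReal y)
    (l : Fin d1 → ℝ) (r : Fin d2 → ℝ) :
    g x * (∏ i, p i (l i)) * (∏ j, q j (r j)) ≤
      ENNReal.ofReal (Real.exp (c₀ + (d1 + d2) * c₁)) *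
        (variancePDF fam a b x * (∏ i, gaussianPDF 0 x.toNNReal (l i)) *
          (∏ j, gaussianPDF 0 x.toNNReal (r j))) := by
  by_cases hx : g x = 0
  · simp [hx]
  calc g x * (∏ i, p i (l i)) * (∏ j, q j (r j))
      ≤ (ENNReal.ofReal (Real.exp c₀) * variancePDF fam a b x) *
        (ENNReal.ofReal (Real.exp (d1 * c₁)) * ∏ i, gaussianPDF 0 x.toNNReal (l i)) *
        (ENNReal.ofReal (Real.exp (d2 * c₁)) * ∏ j, gaussianPDF 0 x.toNNReal (r j)) :=
        mul_le_mul' (mul_le_mul' (hg hx) (prod_le_ofReal_exp_mul_prod (hp hx) l))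
          (prod_le_ofReal_exp_mul_prod (hq hx) r)
    _ = _ := by
        rw [add_mul, ← add_assoc, Real.exp_add, Real.exp_add, ENNReal.ofReal_mul (by positivity),
          ENNReal.ofReal_mul (by positivity)]
        ring

end Factorized

section OneDimensional

/-- The density of the uniform law on `[lo, hi]`. -/
noncomputable def uniformDensity (lo hi : ℝ) : ℝ → ℝ≥0∞ :=
  (Set.Icc lo hi).indicator fun _ => ENNReal.ofReal (hi - lo)⁻¹

lemma measurable_uniformDensity (lo hi : ℝ) : Measurable (uniformDensity lo hi) :=
  measurable_const.indicator measurableSet_Icc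

lemma lintegral_uniformDensity {lo hi : ℝ} (h : lo < hi) : ∫⁻ x, uniformDensity lo hi x = 1 := by
  rw [uniformDensity, lintegral_indicator measurableSet_Icc, setLIntegral_const, Real.volume_Icc,
    ← ENNReal.ofReal_mul (inv_nonneg.mpr (sub_nonneg.mpr h.le)),
    inv_mul_cancel₀ (sub_pos.mpr h).ne', ENNReal.ofReal_one]

lemma mem_Icc_of_uniformDensity_ne_zero {lo hi x : ℝ} (h : uniformDensity lo hi x ≠ 0) :
    x ∈ Set.Icc lo hi :=
  Set.mem_of_indicator_ne_zero h

lemma uniformDensity_le (lo hi x : ℝ) : uniformDensity lo hi x ≤ ENNReal.ofReal (hi - lo)⁻¹ :=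
  Set.indicator_le_self' (fun _ _ => zero_le) x

lemma inv_four_mul_exp_le_gaussianPDFReal {A v x : ℝ} (hv : 1 ≤ v) (hv2 : v ≤ 2) (hx : |x| ≤ A) :
    4⁻¹ * Real.exp (-(A ^ 2 / 2)) ≤ gaussianPDFReal 0 v.toNNReal x := by
  have hsqrt : √(2 * Real.pi * v) ≤ 4 := by
    rw [Real.sqrt_le_left (by norm_num)]
    nlinarith [Real.pi_le_four, Real.pi_pos]
  have hexp : x ^ 2 / (2 * v) ≤ A ^ 2 / 2 :=
    div_le_div₀ (sq_nonneg A) (sq_le_sq.mpr (hx.trans (le_abs_self A))) two_pos (by linarith)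
  simp only [gaussianPDFReal, Real.coe_toNNReal v (by linarith), sub_zero, neg_div]
  gcongr

lemma uniformDensity_le_gaussianPDF {u ε A v : ℝ} (hu : |u| ≤ A) (hε : 0 < ε) (hε1 : ε ≤ 1)
    (hv : 1 ≤ v) (hv2 : v ≤ 2) (x : ℝ) :
    uniformDensity (u - ε) (u + ε) x ≤
      ENNReal.ofReal (Real.exp (Real.log (1 / ε) + 1 + (A + 1) ^ 2 / 2)) *
        gaussianPDF 0 v.toNNReal x := by
  by_cases hx : x ∈ Set.Icc (u - ε) (u + ε)
  swap
  · exact (Set.indicator_of_notMem hx _).trans_le zero_le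
  have hxA : |x| ≤ A + 1 := by
    have hxu : |x - u| ≤ ε := abs_le.mpr ⟨by linarith [hx.1], by linarith [hx.2]⟩
    linarith [abs_sub_abs_le_abs_sub x u]
  refine (uniformDensity_le _ _ _).trans ?_
  rw [gaussianPDF, ← ENNReal.ofReal_mul (Real.exp_pos _).le]
  refine ENNReal.ofReal_le_ofReal ?_
  calc (u + ε - (u - ε))⁻¹ = 1 / ε * 2 * 4⁻¹ := by
        rw [show u + ε - (u - ε) = 2 * ε by ring]; field_simp; norm_num
    _ ≤ 1 / ε * Real.exp 1 * 4⁻¹ := by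
        gcongr
        linarith [Real.add_one_le_exp 1]
    _ = Real.exp (Real.log (1 / ε) + 1 + (A + 1) ^ 2 / 2) *
        (4⁻¹ * Real.exp (-((A + 1) ^ 2 / 2))) := by
        rw [Real.exp_add, Real.exp_add, Real.exp_log (by positivity), Real.exp_neg]
        field_simp
    _ ≤ _ := by
        gcongr
        exact inv_four_mul_exp_le_gaussianPDFReal hv hv2 hxA

/-- The density of the centered Gaussian law with variance `s`, conditioned on `[-t, t]`. -/
noncomputable def truncGaussianDensity (s : NNReal) (t : ℝ) : ℝ → ℝ≥0∞ :=
  (Set.Icc (-t) t).indicator fun x =>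
    (gaussianReal 0 s (Set.Icc (-t) t))⁻¹ * gaussianPDF 0 s x

lemma measurable_truncGaussianDensity (s : NNReal) (t : ℝ) :
    Measurable (truncGaussianDensity s t) :=
  ((measurable_gaussianPDF _ _).const_mul _).indicator measurableSet_Icc

lemma abs_le_of_truncGaussianDensity_ne_zero {s : NNReal} {t x : ℝ}
    (h : truncGaussianDensity s t x ≠ 0) : |x| ≤ t :=
  abs_le.mpr (Set.mem_Icc.mp (Set.mem_of_indicator_ne_zero h))

lemma one_sub_div_sq_le_gaussianReal_Icc (s : NNReal) {t : ℝ} (ht : 0 < t) :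
    ENNReal.ofReal (1 - s / t ^ 2) ≤ gaussianReal 0 s (Set.Icc (-t) t) := by
  have hcheb := meas_ge_le_variance_div_sq (μ := gaussianReal 0 s) (X := id)
    (memLp_id_gaussianReal 2) ht
  rw [variance_id_gaussianReal] at hcheb
  simp only [id_eq, integral_id_gaussianReal] at hcheb
  have hsub : (Set.Icc (-t) t)ᶜ ⊆ {x | t ≤ |x - 0|} := fun x hx => by
    simp only [Set.mem_compl_iff, Set.mem_Icc, ← abs_le, not_le] at hx
    simpa using hx.le
  rw [ENNReal.ofReal_sub _ (by positivity), ENNReal.ofReal_one, tsub_le_iff_right,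
    ← prob_add_prob_compl (μ := gaussianReal 0 s) (measurableSet_Icc (a := -t) (b := t))]
  gcongr
  exact (measure_mono hsub).trans hcheb

lemma lintegral_truncGaussianDensity {s : NNReal} (hs : s ≠ 0) {t : ℝ} (ht : 0 < t)
    (hst : s < t ^ 2) : ∫⁻ x, truncGaussianDensity s t x = 1 := by
  have hmass : gaussianReal 0 s (Set.Icc (-t) t) ≠ 0 := by
    refine (lt_of_lt_of_le ?_ (one_sub_div_sq_le_gaussianReal_Icc s ht)).ne'
    rwa [ENNReal.ofReal_pos, sub_pos, div_lt_one (by positivity)]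
  rw [truncGaussianDensity, lintegral_indicator measurableSet_Icc,
    lintegral_const_mul _ (measurable_gaussianPDF _ _), ← gaussianReal_apply 0 hs]
  exact ENNReal.inv_mul_cancel hmass (measure_ne_top _ _)

lemma inv_gaussianReal_Icc_le {s : NNReal} {t D : ℝ} (ht : 0 < t) (hD : 1 ≤ D)
    (hst : 2 * s * D = t ^ 2) :
    (gaussianReal 0 s (Set.Icc (-t) t))⁻¹ ≤ ENNReal.ofReal (Real.exp (1 / D)) := by
  have hratio : (s : ℝ) / t ^ 2 = 1 / D / 2 := by
    rw [div_eq_div_iff (by positivity) two_ne_zero, ← hst]; field_simp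
  have hexp : 1 ≤ Real.exp (1 / D) * (1 - s / t ^ 2) := by
    have hD1 : 1 / D ≤ 1 := (div_le_one (by positivity)).mpr hD
    have hD0 : 0 < 1 / D := by positivity
    rw [hratio]
    nlinarith [Real.add_one_le_exp (1 / D)]
  rw [ENNReal.inv_le_iff_le_mul (fun h => absurd h ENNReal.ofReal_ne_top)
    fun h => absurd h (measure_ne_top _ _)]
  calc (1 : ℝ≥0∞) ≤ ENNReal.ofReal (Real.exp (1 / D)) * ENNReal.ofReal (1 - s / t ^ 2) := by
        rwa [← ENNReal.ofReal_mul (Real.exp_pos _).le, ENNReal.one_le_ofReal]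
    _ ≤ _ := by
        rw [mul_comm]
        gcongr
        exact one_sub_div_sq_le_gaussianReal_Icc s ht

lemma gaussianPDFReal_le_mul_of_variance_le {s v c : ℝ} (hs : 0 < s) (hsv : s ≤ v) (hc : 0 ≤ c)
    (hvs : v ≤ c ^ 2 * s) (x : ℝ) :
    gaussianPDFReal 0 s.toNNReal x ≤ c * gaussianPDFReal 0 v.toNNReal x := by
  have hv : 0 < v := hs.trans_le hsv
  simp only [gaussianPDFReal, Real.coe_toNNReal _ hs.le, Real.coe_toNNReal _ hv.le, sub_zero]
  have hexp : Real.exp (-x ^ 2 / (2 * s)) ≤ Real.exp (-x ^ 2 / (2 * v)) := by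
    rw [neg_div, neg_div]; gcongr
  have hsqrt : √(2 * Real.pi * v) ≤ c * √(2 * Real.pi * s) := by
    rw [Real.sqrt_le_left (by positivity), mul_pow, Real.sq_sqrt (by positivity)]
    calc 2 * Real.pi * v ≤ 2 * Real.pi * (c ^ 2 * s) := by gcongr
      _ = c ^ 2 * (2 * Real.pi * s) := by ring
  have hinv : (√(2 * Real.pi * s))⁻¹ ≤ c * (√(2 * Real.pi * v))⁻¹ := by
    rw [← div_eq_mul_inv, le_div_iff₀ (by positivity), inv_mul_le_iff₀ (by positivity),
      mul_comm _ c]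
    exact hsqrt
  calc _ ≤ (c * (√(2 * Real.pi * v))⁻¹) * Real.exp (-x ^ 2 / (2 * v)) := by gcongr
    _ = _ := mul_assoc _ _ _

lemma truncGaussianDensity_le_gaussianPDF {s t D v : ℝ} (hs : 0 < s) (ht : 0 < t) (hD : 1 ≤ D)
    (hst : 2 * s * D = t ^ 2) (hsv : s ≤ v) (hvs : v ≤ s * (1 + 1 / D)) (x : ℝ) :
    truncGaussianDensity s.toNNReal t x ≤
      ENNReal.ofReal (Real.exp (2 / D)) * gaussianPDF 0 v.toNNReal x := by
  have hexp : 1 + 1 / D ≤ Real.exp (1 / D) ^ 2 := by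
    have hD0 : 0 < 1 / D := by positivity
    nlinarith [Real.add_one_le_exp (1 / D)]
  have hgauss : gaussianPDF 0 s.toNNReal x ≤
      ENNReal.ofReal (Real.exp (1 / D)) * gaussianPDF 0 v.toNNReal x := by
    rw [gaussianPDF, gaussianPDF, ← ENNReal.ofReal_mul (Real.exp_pos _).le]
    refine ENNReal.ofReal_le_ofReal
      (gaussianPDFReal_le_mul_of_variance_le hs hsv (Real.exp_pos _).le ?_ x)
    rw [mul_comm]
    exact hvs.trans (by gcongr)
  calc truncGaussianDensity s.toNNReal t x
      ≤ (gaussianReal 0 s.toNNReal (Set.Icc (-t) t))⁻¹ * gaussianPDF 0 s.toNNReal x :=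
        Set.indicator_le_self' (fun _ _ => zero_le) x
    _ ≤ ENNReal.ofReal (Real.exp (1 / D)) *
        (ENNReal.ofReal (Real.exp (1 / D)) * gaussianPDF 0 v.toNNReal x) :=
        mul_le_mul' (inv_gaussianReal_Icc_le ht hD (by rwa [Real.coe_toNNReal s hs.le])) hgauss
    _ = _ := by
        rw [← mul_assoc, ← ENNReal.ofReal_mul (Real.exp_pos _).le, ← Real.exp_add, ← add_div,
          one_add_one_eq_two]

end OneDimensional

section Competitor

variable {d d1 d2 m : ℕ} {S : Finset (Fin m)} {A D η δ : ℝ} {fam : VarianceFamily} {a b c₀ : ℝ}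

/-- The densities of the entries of a factor under the comparison law: in the active columns
(those of `S`) the entries are uniform near the entries of `W`, in the other columns they are
centered Gaussian with the small variance `η / (2 * D)`, truncated to `[-√η, √η]`. -/
noncomputable def factorDensity (S : Finset (Fin m)) (A D η : ℝ) (W : Matrix (Fin d) (Fin m) ℝ)
    (i : Fin d) (k : Fin m) : ℝ → ℝ≥0∞ :=
  if k ∈ S then uniformDensity (W i k - η / (2 * A + 1)) (W i k + η / (2 * A + 1))
  else truncGaussianDensity (η / (2 * D)).toNNReal √η

/-- The densities of the column variances under the comparison law: uniform on `[1, 2]` in the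
active columns, and concentrated near `η / (2 * D)` in the others. -/
noncomputable def varianceDensity (S : Finset (Fin m)) (D η : ℝ) (k : Fin m) : ℝ → ℝ≥0∞ :=
  if k ∈ S then uniformDensity 1 2
  else uniformDensity (η / (2 * D)) (η / (2 * D) * (1 + 1 / D))

/-- The comparison law: a fully factorized law of the parameters that concentrates near the
matrix `U * Vᵀ`, where the columns of `U` and `V` outside of `S` are regarded as zero. -/
noncomputable def competitor (S : Finset (Fin m)) (A η : ℝ) (U : Matrix (Fin d1) (Fin m) ℝ)
    (V : Matrix (Fin d2) (Fin m) ℝ) : Measure (Params d1 d2 m) :=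
  volume.withDensity (productDensity (factorDensity S A (d1 + d2) η U)
    (factorDensity S A (d1 + d2) η V) (varianceDensity S (d1 + d2) η))

/-- The logarithm of the factor by which the density of the comparison law may exceed that of the
hierarchical model in column `k`, when the density of `π^γ` is at least `exp (-c₀)`. -/
noncomputable def columnCost (S : Finset (Fin m)) (A D η c₀ : ℝ) (k : Fin m) : ℝ :=
  if k ∈ S then c₀ + D * (Real.log ((2 * A + 1) / η) + 1 + (A + 1) ^ 2 / 2)
  else Real.log (2 * D ^ 2 / η) + c₀ + 2

lemma measurable_factorDensity (W : Matrix (Fin d) (Fin m) ℝ) (i : Fin d) (k : Fin m) :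
    Measurable (factorDensity S A D η W i k) := by
  unfold factorDensity
  split_ifs
  exacts [measurable_uniformDensity _ _, measurable_truncGaussianDensity _ _]

lemma measurable_varianceDensity (k : Fin m) : Measurable (varianceDensity S D η k) := by
  unfold varianceDensity
  split_ifs <;> exact measurable_uniformDensity _ _

lemma lintegral_factorDensity (hA : 0 ≤ A) (hD : 1 ≤ D) (hη : 0 < η)
    (W : Matrix (Fin d) (Fin m) ℝ) (i : Fin d) (k : Fin m) :
    ∫⁻ x, factorDensity S A D η W i k x = 1 := by
  unfold factorDensity
  split_ifs
  · have : 0 < η / (2 * A + 1) := by positivity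
    exact lintegral_uniformDensity (by linarith)
  · have hs : 0 < η / (2 * D) := by positivity
    refine lintegral_truncGaussianDensity (by simpa using hs) (Real.sqrt_pos.mpr hη) ?_
    rw [Real.coe_toNNReal _ hs.le, Real.sq_sqrt hη.le]
    exact div_lt_self hη (by linarith)

lemma lintegral_varianceDensity (hD : 1 ≤ D) (hη : 0 < η) (k : Fin m) :
    ∫⁻ x, varianceDensity S D η k x = 1 := by
  unfold varianceDensity
  split_ifs
  · exact lintegral_uniformDensity one_lt_two
  · have : 0 < 1 / D := by positivity
    exact lintegral_uniformDensity (lt_mul_of_one_lt_right (by positivity) (by linarith))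

lemma competitor_mem_fullyFactorized (hA : 0 ≤ A) (hη : 0 < η) (hd : 1 ≤ d1 + d2)
    (U : Matrix (Fin d1) (Fin m) ℝ) (V : Matrix (Fin d2) (Fin m) ℝ) :
    competitor S A η U V ∈ fullyFactorized d1 d2 m := by
  have hD : (1 : ℝ) ≤ d1 + d2 := by exact_mod_cast hd
  exact withDensity_productDensity_mem_fullyFactorized (measurable_factorDensity U)
    (measurable_factorDensity V) measurable_varianceDensity (lintegral_factorDensity hA hD hη U)
    (lintegral_factorDensity hA hD hη V) (lintegral_varianceDensity hD hη)

lemma abs_mul_sub_mul_le {x y u v ε : ℝ} (hx : |x - u| ≤ ε) (hy : |y - v| ≤ ε) (hu : |u| ≤ A)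
    (hv : |v| ≤ A) (hε1 : ε ≤ 1) : |x * y - u * v| ≤ (2 * A + 1) * ε := by
  have hε : 0 ≤ ε := (abs_nonneg _).trans hx
  have hA : 0 ≤ A := (abs_nonneg _).trans hu
  have hyA : |y| ≤ A + 1 := by linarith [abs_sub_abs_le_abs_sub y v]
  calc |x * y - u * v| = |(x - u) * y + u * (y - v)| := by congr 1; ring
    _ ≤ |x - u| * |y| + |u| * |y - v| := by
        rw [← abs_mul, ← abs_mul]; exact abs_add_le _ _
    _ ≤ ε * (A + 1) + A * ε := by gcongr
    _ = (2 * A + 1) * ε := by ring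

lemma abs_mul_sub_mul_le_of_factorDensity_ne_zero (hη : 0 ≤ η) (hη1 : η ≤ 1)
    {U : Matrix (Fin d1) (Fin m) ℝ} {V : Matrix (Fin d2) (Fin m) ℝ} {i : Fin d1} {j : Fin d2}
    {k : Fin m} (hU : |U i k| ≤ A) (hV : |V j k| ≤ A) (hUS : k ∉ S → U i k = 0) {x y : ℝ}
    (hx : factorDensity S A D η U i k x ≠ 0) (hy : factorDensity S A D η V j k y ≠ 0) :
    |x * y - U i k * V j k| ≤ η := by
  have hA : 0 ≤ A := (abs_nonneg _).trans hU
  unfold factorDensity at hx hy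
  split_ifs at hx hy with hk
  · have hxε := abs_sub_le_iff.mpr
      ((mem_Icc_of_uniformDensity_ne_zero hx).symm.imp sub_le_iff_le_add'.mpr sub_le_comm.mp)
    have hyε := abs_sub_le_iff.mpr
      ((mem_Icc_of_uniformDensity_ne_zero hy).symm.imp sub_le_iff_le_add'.mpr sub_le_comm.mp)
    refine (abs_mul_sub_mul_le hxε hyε hU hV ?_).trans_eq (by field_simp)
    exact (div_le_one (by positivity)).mpr (by linarith)
  · rw [hUS hk, zero_mul, sub_zero, abs_mul, ← Real.mul_self_sqrt hη]
    exact mul_le_mul (abs_le_of_truncGaussianDensity_ne_zero hx)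
      (abs_le_of_truncGaussianDensity_ne_zero hy) (abs_nonneg _) (Real.sqrt_nonneg η)

lemma ae_competitor_abs_toMatrix_sub_le (hη : 0 ≤ η) (hη1 : η ≤ 1)
    {U : Matrix (Fin d1) (Fin m) ℝ} {V : Matrix (Fin d2) (Fin m) ℝ} (hU : ∀ i k, |U i k| ≤ A)
    (hV : ∀ j k, |V j k| ≤ A) (hUS : ∀ i, ∀ k ∉ S, U i k = 0) :
    ∀ᵐ θ ∂(competitor S A η U V), ∀ i j, |toMatrix θ i j - (U * V.transpose) i j| ≤ m * η := by
  filter_upwards [ae_ne_zero_withDensity_productDensity (measurable_factorDensity U)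
    (measurable_factorDensity V) measurable_varianceDensity] with θ hθ i j
  calc |toMatrix θ i j - (U * V.transpose) i j|
      = |∑ k, (θ.1 i k * θ.2.1 j k - U i k * V j k)| := by
        rw [toMatrix_apply, Matrix.mul_apply, Finset.sum_sub_distrib]; rfl
    _ ≤ ∑ _k : Fin m, η := (Finset.abs_sum_le_sum_abs _ _).trans <| Finset.sum_le_sum fun k _ =>
        abs_mul_sub_mul_le_of_factorDensity_ne_zero hη hη1 (hU i k) (hV j k) (hUS i k)
          (hθ.1 i k) (hθ.2 j k)
    _ = m * η := by simp

lemma factorDensity_le_of_mem (hA : 0 ≤ A) (hη : 0 < η) (hη1 : η ≤ 1)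
    {W : Matrix (Fin d) (Fin m) ℝ} {i : Fin d} {k : Fin m} (hW : |W i k| ≤ A) (hk : k ∈ S) {v : ℝ}
    (hv : varianceDensity S D η k v ≠ 0) (x : ℝ) :
    factorDensity S A D η W i k x ≤
      ENNReal.ofReal (Real.exp (Real.log ((2 * A + 1) / η) + 1 + (A + 1) ^ 2 / 2)) *
        gaussianPDF 0 v.toNNReal x := by
  rw [varianceDensity, if_pos hk] at hv
  rw [factorDensity, if_pos hk, ← one_div_div η]
  have hv12 := mem_Icc_of_uniformDensity_ne_zero hv
  exact uniformDensity_le_gaussianPDF hW (by positivity)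
    ((div_le_one (by positivity)).mpr (by linarith)) hv12.1 hv12.2 x

lemma factorDensity_le_of_notMem (hD : 1 ≤ D) (hη : 0 < η) {W : Matrix (Fin d) (Fin m) ℝ}
    {i : Fin d} {k : Fin m} (hk : k ∉ S) {v : ℝ} (hv : varianceDensity S D η k v ≠ 0) (x : ℝ) :
    factorDensity S A D η W i k x ≤
      ENNReal.ofReal (Real.exp (2 / D)) * gaussianPDF 0 v.toNNReal x := by
  rw [varianceDensity, if_neg hk] at hv
  rw [factorDensity, if_neg hk]
  have hvs := mem_Icc_of_uniformDensity_ne_zero hv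
  refine truncGaussianDensity_le_gaussianPDF (by positivity) (Real.sqrt_pos.mpr hη) hD ?_
    hvs.1 hvs.2 x
  rw [Real.sq_sqrt hη.le]
  field_simp

lemma varianceDensity_le_of_mem
    (hact : ∀ x ∈ Set.Icc (1 : ℝ) 2, 1 ≤ ENNReal.ofReal (Real.exp c₀) * variancePDF fam a b x)
    {k : Fin m} (hk : k ∈ S) {x : ℝ} (hx : varianceDensity S D η k x ≠ 0) :
    varianceDensity S D η k x ≤ ENNReal.ofReal (Real.exp c₀) * variancePDF fam a b x := by
  rw [varianceDensity, if_pos hk] at hx ⊢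
  refine le_trans ?_ (hact x (mem_Icc_of_uniformDensity_ne_zero hx))
  exact (uniformDensity_le _ _ _).trans (by norm_num)

lemma varianceDensity_le_of_notMem (hD : 1 ≤ D) (hη : 0 < η) {k : Fin m} (hk : k ∉ S)
    (hinact : ∀ x ∈ Set.Icc (η / (2 * D)) (η / D),
      1 ≤ ENNReal.ofReal (Real.exp c₀) * variancePDF fam a b x)
    {x : ℝ} (hx : varianceDensity S D η k x ≠ 0) :
    varianceDensity S D η k x ≤
      ENNReal.ofReal (Real.exp (Real.log (2 * D ^ 2 / η) + c₀)) * variancePDF fam a b x := by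
  rw [varianceDensity, if_neg hk] at hx ⊢
  have hxs := mem_Icc_of_uniformDensity_ne_zero hx
  have hxD : x ≤ η / D := by
    have hD1 : 1 / D ≤ 1 := (div_le_one (by positivity)).mpr hD
    calc x ≤ η / (2 * D) * (1 + 1) := hxs.2.trans (by gcongr)
      _ = η / D := by field_simp; norm_num
  have hwidth : (η / (2 * D) * (1 + 1 / D) - η / (2 * D))⁻¹ = 2 * D ^ 2 / η := by
    field_simp; ring
  refine (uniformDensity_le _ _ _).trans ?_
  rw [hwidth, Real.exp_add, Real.exp_log (by positivity), ENNReal.ofReal_mul (by positivity),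
    mul_assoc]
  exact le_mul_of_one_le_right' (hinact x ⟨hxs.1, hxD⟩)

lemma competitor_le_smul_hierarchicalPrior (hA : 0 ≤ A) (hη : 0 < η) (hη1 : η ≤ 1)
    (hd : 1 ≤ d1 + d2) {U : Matrix (Fin d1) (Fin m) ℝ} {V : Matrix (Fin d2) (Fin m) ℝ}
    (hU : ∀ i k, |U i k| ≤ A) (hV : ∀ j k, |V j k| ≤ A)
    (hact : ∀ x ∈ Set.Icc (1 : ℝ) 2, 1 ≤ ENNReal.ofReal (Real.exp c₀) * variancePDF fam a b x)
    (hinact : ∀ k ∉ S, ∀ x ∈ Set.Icc (η / (2 * (d1 + d2))) (η / (d1 + d2)),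
      1 ≤ ENNReal.ofReal (Real.exp c₀) * variancePDF fam a b x) :
    competitor S A η U V ≤ ENNReal.ofReal (Real.exp (∑ k, columnCost S A (d1 + d2) η c₀ k)) •
      hierarchicalPrior d1 d2 m fam a b := by
  have hD : (1 : ℝ) ≤ d1 + d2 := by exact_mod_cast hd
  refine withDensity_productDensity_le_smul_hierarchicalPrior fun k x l r => ?_
  by_cases hk : k ∈ S
  · rw [columnCost, if_pos hk]
    exact column_le (p := fun i => factorDensity S A _ η U i k)
      (q := fun j => factorDensity S A _ η V j k) (varianceDensity_le_of_mem hact hk)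
      (fun hx i => factorDensity_le_of_mem hA hη hη1 (hU i k) hk hx)
      (fun hx j => factorDensity_le_of_mem hA hη hη1 (hV j k) hk hx) l r
  · have hcost : columnCost S A (d1 + d2) η c₀ k =
        Real.log (2 * (d1 + d2) ^ 2 / η) + c₀ + (d1 + d2) * (2 / (d1 + d2)) := by
      rw [columnCost, if_neg hk, mul_div_cancel₀ _ (by positivity)]
    rw [hcost]
    exact column_le (p := fun i => factorDensity S A _ η U i k)
      (q := fun j => factorDensity S A _ η V j k)
      (varianceDensity_le_of_notMem hD hη hk (hinact k hk))
      (fun hx i => factorDensity_le_of_notMem hD hη hk hx)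
      (fun hx j => factorDensity_le_of_notMem hD hη hk hx) l r

-- The competitor is centered at `(1 - δ) • M` instead of the sign matrix `M` itself: a matrix
-- within `δ` of it has entries in `[-1, 1]`, so its parameters stay in `Θ` even for `B = 2`.
lemma exists_fullyFactorized_le_smul_prior {B : ℝ} (ha : 0 < a) (hb : 0 < b) (hB : 2 ≤ B)
    (hd : 1 ≤ d1 + d2) {U : Matrix (Fin d1) (Fin m) ℝ} {V : Matrix (Fin d2) (Fin m) ℝ}
    (hA : 0 ≤ A) (hU : ∀ i k, |U i k| ≤ A) (hV : ∀ j k, |V j k| ≤ A)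
    (hUS : ∀ i, ∀ k ∉ S, U i k = 0) (hM : ∀ i j, |(U * V.transpose) i j| = 1)
    (hη : 0 < η) (hη1 : η ≤ 1) (hδ : δ ≤ 1) (hmη : m * η ≤ δ)
    (hact : ∀ x ∈ Set.Icc (1 : ℝ) 2, 1 ≤ ENNReal.ofReal (Real.exp c₀) * variancePDF fam a b x)
    (hinact : ∀ k ∉ S, ∀ x ∈ Set.Icc (η / (2 * (d1 + d2))) (η / (d1 + d2)),
      1 ≤ ENNReal.ofReal (Real.exp c₀) * variancePDF fam a b x) :
    ∃ ρ ∈ fullyFactorized d1 d2 m,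
      ρ ≤ ENNReal.ofReal (Real.exp (∑ k, columnCost S A (d1 + d2) η c₀ k)) •
        prior d1 d2 m fam a b B ∧
      ∀ᵐ θ ∂ρ, ∀ i j, |toMatrix θ i j - (U * V.transpose) i j| ≤ 2 * δ := by
  have hδ0 : 0 ≤ δ := le_trans (by positivity) hmη
  have hUδ (i k) : |((1 - δ) • U) i k| ≤ A := by
    rw [Matrix.smul_apply, smul_eq_mul, abs_mul, abs_of_nonneg (sub_nonneg.mpr hδ)]
    exact (mul_le_of_le_one_left (abs_nonneg _) (by linarith)).trans (hU i k)
  have hclose : ∀ᵐ θ ∂(competitor S A η ((1 - δ) • U) V), ∀ i j,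
      |toMatrix θ i j - (1 - δ) * (U * V.transpose) i j| ≤ δ := by
    filter_upwards [ae_competitor_abs_toMatrix_sub_le hη.le hη1 hUδ hV
      fun i k hk => by simp [hUS i k hk]] with θ hθ i j
    simpa using (hθ i j).trans hmη
  refine ⟨competitor S A η ((1 - δ) • U) V, competitor_mem_fullyFactorized hA hη hd _ _,
    le_smul_prior fam ha hb
      (competitor_le_smul_hierarchicalPrior hA hη hη1 hd hUδ hV hact hinact) ?_, ?_⟩
  · filter_upwards [hclose] with θ hθ
    refine mem_paramSet_of_abs_le fun i j => ?_
    have habs := abs_sub_abs_le_abs_sub (toMatrix θ i j) ((1 - δ) * (U * V.transpose) i j)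
    rw [abs_mul, hM, mul_one, abs_of_nonneg (sub_nonneg.mpr hδ)] at habs
    linarith [hθ i j]
  · filter_upwards [hclose] with θ hθ i j
    calc |toMatrix θ i j - (U * V.transpose) i j|
        = |(toMatrix θ i j - (1 - δ) * (U * V.transpose) i j) -
            δ * (U * V.transpose) i j| := by congr 1; ring
      _ ≤ δ + δ := by
          refine (abs_sub _ _).trans (add_le_add (hθ i j) ?_)
          rw [abs_mul, hM, mul_one, abs_of_nonneg hδ0]
      _ = 2 * δ := (two_mul δ).symm

end Competitor

section Rates

variable {A a b κ l n D N x : ℝ}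

/-- The cost of one variance coordinate of the comparison law: the density of `π^γ` on the support
of that coordinate is at least `exp (-varianceCost a κ * log N)`, where `N = n d₁ d₂`. -/
noncomputable def varianceCost (a κ : ℝ) : ℝ :=
  2 * a * Real.log κ + a * κ + 2 * |Real.log (Real.Gamma a)| +
    (a + 1) * (2 * Real.log (2 * κ) + 3) + 4 * κ + 8 * κ ^ 2

/-- The cost of the comparison law: its divergence from the prior is at most
`competitorCost a A κ * (r (d₁ + d₂) log N)`, where `N = n d₁ d₂`. -/
noncomputable def competitorCost (a A κ : ℝ) : ℝ :=
  κ * (2 * varianceCost a κ + 2 * Real.log ((2 * A + 1) * κ) + (A + 1) ^ 2 + 2 * Real.log (2 * κ)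
    + 12)

lemma varianceCost_nonneg (ha : 0 < a) (hκ : 1 ≤ κ) : 0 ≤ varianceCost a κ := by
  have hlogκ := Real.log_nonneg hκ
  have hlog2κ : 0 ≤ Real.log (2 * κ) := Real.log_nonneg (by linarith)
  unfold varianceCost
  positivity

lemma competitorCost_nonneg (ha : 0 < a) (hA : 0 ≤ A) (hκ : 1 ≤ κ) :
    0 ≤ competitorCost a A κ := by
  have hvar := varianceCost_nonneg ha hκ
  have hlogA : 0 ≤ Real.log ((2 * A + 1) * κ) := Real.log_nonneg (by nlinarith)
  have hlog2κ : 0 ≤ Real.log (2 * κ) := Real.log_nonneg (by linarith)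
  unfold competitorCost
  positivity

lemma one_half_le_log (hN : 2 ≤ N) : 1 / 2 ≤ Real.log N := by
  have hlog2 := Real.log_two_gt_d9
  linarith [Real.log_le_log two_pos hN]

lemma le_two_mul_mul (hl : 1 / 2 ≤ l) (hx : 0 ≤ x) : x ≤ 2 * x * l := by
  nlinarith

lemma variance_exponent_le (ha : 0 < a) (hκ : 1 ≤ κ) (hl : 1 / 2 ≤ l) :
    a * (Real.log κ + κ * l) + Real.log (Real.Gamma a) + (a + 1) * (Real.log (2 * κ) + 3 * l) +
      2 * κ + 4 * κ ^ 2 ≤ varianceCost a κ * l := by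
  have hlogκ := le_two_mul_mul hl (mul_nonneg ha.le (Real.log_nonneg hκ))
  have hlogΓ := le_two_mul_mul hl (abs_nonneg (Real.log (Real.Gamma a)))
  have hlog2κ := le_two_mul_mul hl (mul_nonneg (by linarith : 0 ≤ a + 1)
    (Real.log_nonneg (by linarith : 1 ≤ 2 * κ)))
  have hκl := le_two_mul_mul hl (by linarith : 0 ≤ κ)
  have hκ2l := le_two_mul_mul hl (sq_nonneg κ)
  unfold varianceCost
  linarith [le_abs_self (Real.log (Real.Gamma a))]

lemma one_le_ofReal_exp_mul_variancePDF (fam : VarianceFamily) {β Λ T : ℝ} (ha : 0 < a)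
    (hb : 0 < b) (hbκ : b ≤ κ) (hβ : -β ≤ Real.log b) (hx : 0 < x) (hx2 : x ≤ 2)
    (hΛ : |Real.log x| ≤ Λ) (hT : 0 ≤ T) (hfam : fam = .gamma ∨ b / x ≤ T) :
    1 ≤ ENNReal.ofReal (Real.exp (a * β + Real.log (Real.Gamma a) + (a + 1) * Λ + 2 * κ + T)) *
      variancePDF fam a b x := by
  have hnorm : b ^ a / Real.Gamma a = Real.exp (a * Real.log b - Real.log (Real.Gamma a)) := by
    rw [Real.exp_sub, Real.exp_log (Real.Gamma_pos_of_pos ha), Real.rpow_def_of_pos hb, mul_comm]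
  have hlogb : -(a * β) ≤ a * Real.log b := by nlinarith
  obtain ⟨hlogx, hlogx'⟩ := abs_le.mp hΛ
  have hκ : 0 < κ := hb.trans_le hbκ
  cases fam
  · rw [variancePDF, gammaPDF_of_nonneg hx.le, ← ENNReal.ofReal_mul (Real.exp_pos _).le,
      ENNReal.one_le_ofReal, hnorm, Real.rpow_def_of_pos hx, ← Real.exp_add, ← Real.exp_add,
      ← Real.exp_add]
    have hbx : b * x ≤ κ * 2 := by gcongr
    have hpow : -((a + 1) * Λ) ≤ Real.log x * (a - 1) := by nlinarith
    exact Real.one_le_exp (by linarith)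
  · have hbx : b / x ≤ T := by simpa using hfam
    rw [variancePDF, invGammaPDF, if_pos hx, ← ENNReal.ofReal_mul (Real.exp_pos _).le,
      ENNReal.one_le_ofReal, hnorm, Real.rpow_def_of_pos hx, ← Real.exp_add, ← Real.exp_add,
      ← Real.exp_add]
    have hpow : -((a + 1) * Λ) ≤ Real.log x * (-a - 1) := by nlinarith
    exact Real.one_le_exp (by linarith)

lemma one_le_ofReal_exp_varianceCost_mul_variancePDF (fam : VarianceFamily) (ha : 0 < a)
    (hκ : 1 ≤ κ) (hN : 2 ≤ N) (hb : 1 / (κ * N ^ κ) ≤ b) (hbκ : b ≤ κ) (hx : 0 < x) (hx2 : x ≤ 2)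
    (hlogx : |Real.log x| ≤ Real.log (2 * κ) + 3 * Real.log N)
    (hfam : fam = .gamma ∨ b / x ≤ 4 * κ ^ 2) :
    1 ≤ ENNReal.ofReal (Real.exp (varianceCost a κ * Real.log N)) * variancePDF fam a b x := by
  have hb0 : 0 < b := lt_of_lt_of_le (by positivity) hb
  have hlogb : -(Real.log κ + κ * Real.log N) ≤ Real.log b := by
    rw [← Real.log_rpow (by positivity), ← Real.log_mul (by positivity) (by positivity),
      ← Real.log_inv, ← one_div]
    exact Real.log_le_log (by positivity) hb
  refine (one_le_ofReal_exp_mul_variancePDF fam ha hb0 hbκ hlogb hx hx2 hlogx (by positivity)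
    hfam).trans ?_
  gcongr
  exact variance_exponent_le ha hκ (one_half_le_log hN)

lemma one_le_ofReal_exp_varianceCost_mul_variancePDF_of_mem_Icc_one_two (fam : VarianceFamily)
    (ha : 0 < a) (hκ : 1 ≤ κ) (hN : 2 ≤ N) (hb : 1 / (κ * N ^ κ) ≤ b) (hbκ : b ≤ κ)
    (hx : x ∈ Set.Icc 1 2) :
    1 ≤ ENNReal.ofReal (Real.exp (varianceCost a κ * Real.log N)) * variancePDF fam a b x := by
  have hx0 : 0 < x := by linarith [hx.1]
  have hb0 : 0 < b := lt_of_lt_of_le (by positivity) hb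
  refine one_le_ofReal_exp_varianceCost_mul_variancePDF fam ha hκ hN hb hbκ hx0 hx.2 ?_ (.inr ?_)
  · rw [abs_of_nonneg (Real.log_nonneg hx.1)]
    have hlog2 : Real.log x ≤ Real.log N := Real.log_le_log hx0 (hx.2.trans hN)
    have hlogκ : 0 ≤ Real.log (2 * κ) := Real.log_nonneg (by linarith)
    linarith [Real.log_nonneg hx.1]
  · calc b / x ≤ b := div_le_self hb0.le hx.1
      _ ≤ 4 * κ ^ 2 := by nlinarith

lemma one_le_ofReal_exp_varianceCost_mul_variancePDF_of_mem_Icc_small (fam : VarianceFamily)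
    (ha : 0 < a) (hκ : 1 ≤ κ) (hn : 1 ≤ n) (hD : 1 ≤ D) (hnN : n ≤ N) (hDN : D ≤ N) (hN : 2 ≤ N)
    (hb : 1 / (κ * N ^ κ) ≤ b) (hbκ : b ≤ κ) (hfam : fam = .gamma ∨ b ≤ κ / N ^ 4)
    (hx : x ∈ Set.Icc (1 / (κ * n ^ 2) / (2 * D)) (1 / (κ * n ^ 2) / D)) :
    1 ≤ ENNReal.ofReal (Real.exp (varianceCost a κ * Real.log N)) * variancePDF fam a b x := by
  have hx0 : 0 < x := lt_of_lt_of_le (by positivity) hx.1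
  have hx1 : x ≤ 1 := by
    refine hx.2.trans ?_
    rw [div_div, div_le_one (by positivity)]
    exact one_le_mul_of_one_le_of_one_le
      (one_le_mul_of_one_le_of_one_le hκ (one_le_pow₀ hn)) hD
  have hinv : x⁻¹ ≤ 2 * κ * N ^ 3 := by
    calc x⁻¹ ≤ (1 / (κ * n ^ 2) / (2 * D))⁻¹ := inv_anti₀ (by positivity) hx.1
      _ = 2 * κ * (n ^ 2 * D) := by field_simp
      _ ≤ 2 * κ * (N ^ 2 * N) := by gcongr
      _ = 2 * κ * N ^ 3 := by ring
  refine one_le_ofReal_exp_varianceCost_mul_variancePDF fam ha hκ hN hb hbκ hx0 (by linarith) ?_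
    (hfam.imp_right fun hb4 => ?_)
  · rw [abs_of_nonpos (Real.log_nonpos hx0.le hx1), ← Real.log_inv]
    refine (Real.log_le_log (by positivity) hinv).trans_eq ?_
    rw [Real.log_mul (by positivity) (by positivity), Real.log_pow]
    norm_num
  · calc b / x = b * x⁻¹ := div_eq_mul_inv b x
      _ ≤ κ / N ^ 4 * (2 * κ * N ^ 3) := by gcongr
      _ = 2 * κ ^ 2 / N := by field_simp
      _ ≤ 2 * κ ^ 2 := div_le_self (by positivity) (by linarith)
      _ ≤ 4 * κ ^ 2 := by nlinarith

variable {m : ℕ} {S : Finset (Fin m)} {k : Fin m} {G : ℝ}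

lemma columnCost_le_of_mem (hκ : 1 ≤ κ) (hA : 0 ≤ A) (hn : 1 ≤ n) (hnl : Real.log n ≤ l)
    (hl : 1 / 2 ≤ l) (hD : 1 ≤ D) (hG : 0 ≤ G) (hk : k ∈ S) :
    columnCost S A D (1 / (κ * n ^ 2)) (G * l) k ≤
      (G + (2 * Real.log ((2 * A + 1) * κ) + 4 + (A + 1) ^ 2)) * (D * l) := by
  have hlog : Real.log ((2 * A + 1) / (1 / (κ * n ^ 2))) =
      Real.log ((2 * A + 1) * κ) + 2 * Real.log n := by
    rw [show (2 * A + 1) / (1 / (κ * n ^ 2)) = (2 * A + 1) * κ * n ^ 2 by field_simp,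
      Real.log_mul (by positivity) (by positivity), Real.log_pow, Nat.cast_ofNat]
  have hlogA := le_two_mul_mul hl
    (Real.log_nonneg (by nlinarith : 1 ≤ (2 * A + 1) * κ))
  have hA2 := le_two_mul_mul hl (by positivity : 0 ≤ (A + 1) ^ 2 / 2)
  calc columnCost S A D (1 / (κ * n ^ 2)) (G * l) k
      = G * l + D * (Real.log ((2 * A + 1) * κ) + 2 * Real.log n + 1 + (A + 1) ^ 2 / 2) := by
        rw [columnCost, if_pos hk, hlog]
    _ ≤ D * (G * l) + D * ((2 * Real.log ((2 * A + 1) * κ) + 4 + (A + 1) ^ 2) * l) := by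
        refine add_le_add (le_mul_of_one_le_left (by positivity) hD) ?_
        gcongr
        linarith
    _ = _ := by ring

lemma columnCost_le_of_notMem (hκ : 1 ≤ κ) (hn : 1 ≤ n) (hnl : Real.log n ≤ l) (hl : 1 / 2 ≤ l)
    (hD : 1 ≤ D) (hDl : Real.log D ≤ l) (hk : k ∉ S) :
    columnCost S A D (1 / (κ * n ^ 2)) (G * l) k ≤ (G + (2 * Real.log (2 * κ) + 8)) * l := by
  have hlog : Real.log (2 * D ^ 2 / (1 / (κ * n ^ 2))) =
      Real.log (2 * κ) + 2 * Real.log n + 2 * Real.log D := by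
    rw [show 2 * D ^ 2 / (1 / (κ * n ^ 2)) = 2 * κ * n ^ 2 * D ^ 2 by field_simp,
      Real.log_mul (by positivity) (by positivity), Real.log_mul (by positivity) (by positivity),
      Real.log_pow, Real.log_pow, Nat.cast_ofNat]
  have hlogκ := le_two_mul_mul hl (Real.log_nonneg (by linarith : 1 ≤ 2 * κ))
  rw [columnCost, if_neg hk, hlog]
  linarith

lemma sum_columnCost_le {r : ℝ} (ha : 0 < a) (hA : 0 ≤ A) (hκ : 1 ≤ κ) (hr : 1 ≤ r) (hn : 1 ≤ n)
    (hnl : Real.log n ≤ l) (hl : 1 / 2 ≤ l) (hD : 1 ≤ D) (hDl : Real.log D ≤ l)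
    (hS : (S.card : ℝ) ≤ κ * r) (hS' : (Sᶜ.card : ℝ) ≤ κ * D) :
    ∑ k, columnCost S A D (1 / (κ * n ^ 2)) (varianceCost a κ * l) k ≤
      competitorCost a A κ * (r * D * l) := by
  have hG := varianceCost_nonneg ha hκ
  have hlogA : 0 ≤ Real.log ((2 * A + 1) * κ) := Real.log_nonneg (by nlinarith)
  have hlogκ : 0 ≤ Real.log (2 * κ) := Real.log_nonneg (by linarith)
  let G₁ := varianceCost a κ + (2 * Real.log ((2 * A + 1) * κ) + 4 + (A + 1) ^ 2)
  let G₂ := varianceCost a κ + (2 * Real.log (2 * κ) + 8)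
  have : 0 ≤ G₁ := by positivity
  have : 0 ≤ G₂ := by positivity
  calc ∑ k, columnCost S A D (1 / (κ * n ^ 2)) (varianceCost a κ * l) k
      = ∑ k ∈ S, columnCost S A D (1 / (κ * n ^ 2)) (varianceCost a κ * l) k +
          ∑ k ∈ Sᶜ, columnCost S A D (1 / (κ * n ^ 2)) (varianceCost a κ * l) k :=
        (Finset.sum_add_sum_compl S _).symm
    _ ≤ S.card • (G₁ * (D * l)) + Sᶜ.card • (G₂ * l) := add_le_add
        (Finset.sum_le_card_nsmul _ _ _ fun k hk =>
          columnCost_le_of_mem hκ hA hn hnl hl hD hG hk)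
        (Finset.sum_le_card_nsmul _ _ _ fun k hk =>
          columnCost_le_of_notMem hκ hn hnl hl hD hDl (Finset.mem_compl.mp hk))
    _ ≤ κ * r * (G₁ * (D * l)) + κ * D * (G₂ * l) := by
        simp only [nsmul_eq_mul]
        gcongr
    _ ≤ κ * r * (G₁ * (D * l)) + r * (κ * D * (G₂ * l)) := by
        grw [← le_mul_of_one_le_left (by positivity : 0 ≤ κ * D * (G₂ * l)) hr]
    _ = competitorCost a A κ * (r * D * l) := by
        simp only [G₁, G₂, competitorCost]
        ring

end Rates

section Oracle

open InformationTheory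

variable {n d1 d2 m r : ℕ} {A B N a b κ : ℝ} {fam : VarianceFamily}
  {U : Matrix (Fin d1) (Fin m) ℝ} {V : Matrix (Fin d2) (Fin m) ℝ}

lemma exists_activeColumns {D : ℝ} {p : Prop} (hκ : 1 ≤ κ) (hD : 0 ≤ D)
    (hU : ∀ i (k : Fin m), r ≤ (k : ℕ) → U i k = 0)
    (hm : (m : ℝ) ≤ κ * r ∨ ((m : ℝ) ≤ κ * D ∧ p)) :
    ∃ S : Finset (Fin m), (∀ i, ∀ k ∉ S, U i k = 0) ∧ (S.card : ℝ) ≤ κ * r ∧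
      (Sᶜ.card : ℝ) ≤ κ * D ∧ ∀ k ∉ S, p := by
  rcases hm with hmr | ⟨hmD, hp⟩
  · refine ⟨Finset.univ, by simp, by simpa using hmr, ?_, by simp⟩
    simp only [Finset.compl_univ, Finset.card_empty, Nat.cast_zero]
    positivity
  · refine ⟨Finset.univ.filter fun k : Fin m => (k : ℕ) < r,
      fun i k hk => hU i k (by simpa using hk), ?_, ?_, fun _ _ => hp⟩
    · rw [Fin.card_filter_val_lt]
      calc ((min m r : ℕ) : ℝ) ≤ r := Nat.cast_le.mpr (min_le_right m r)
        _ ≤ κ * r := le_mul_of_one_le_left (Nat.cast_nonneg r) hκ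
    · refine le_trans ?_ hmD
      exact Nat.cast_le.mpr ((Finset.card_le_univ _).trans_eq (Fintype.card_fin m))

lemma exists_fullyFactorized_klDiv_prior_le (hA : 0 ≤ A) (ha : 0 < a) (hκ : 1 ≤ κ) (hB : 2 ≤ B)
    (hN : 2 ≤ N) (hnN : n ≤ N) (hd : 1 ≤ d1 + d2) (hr : 1 ≤ r) (hrn : r * (d1 + d2) ≤ n)
    (hb : 1 / (κ * N ^ κ) ≤ b) (hbκ : b ≤ κ)
    (hm : (m : ℝ) ≤ κ * r ∨ ((m : ℝ) ≤ κ * (d1 + d2) ∧ (fam = .gamma ∨ b ≤ κ / N ^ 4)))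
    (hUV : (U, V) ∈ factorClass d1 d2 m r A) (hM : ∀ i j, |(U * V.transpose) i j| = 1) :
    ∃ ρ ∈ fullyFactorized d1 d2 m,
      klDiv ρ (prior d1 d2 m fam a b B) ≤
        ENNReal.ofReal (competitorCost a A κ * (r * (d1 + d2) * Real.log N)) ∧
      ∀ᵐ θ ∂ρ, ∀ i j, |toMatrix θ i j - (U * V.transpose) i j| ≤ 2 * (1 / n) := by
  obtain ⟨hU, hV, hU0, -⟩ := hUV
  have hDn : (d1 + d2 : ℝ) ≤ n := by exact_mod_cast (Nat.le_mul_of_pos_left _ hr).trans hrn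
  have hrn : (r : ℝ) ≤ n := by exact_mod_cast (Nat.le_mul_of_pos_right _ hd).trans hrn
  have hr : (1 : ℝ) ≤ r := by exact_mod_cast hr
  have hD : (1 : ℝ) ≤ d1 + d2 := by exact_mod_cast hd
  have hn : (1 : ℝ) ≤ n := hr.trans hrn
  have hb0 : 0 < b := lt_of_lt_of_le (by positivity) hb
  have hη1 : 1 / (κ * (n : ℝ) ^ 2) ≤ 1 :=
    (div_le_one (by positivity)).mpr (one_le_mul_of_one_le_of_one_le hκ (one_le_pow₀ hn))
  have hmη : m * (1 / (κ * n ^ 2)) ≤ 1 / (n : ℝ) := by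
    calc m * (1 / (κ * n ^ 2)) ≤ κ * n * (1 / (κ * n ^ 2)) := by
          gcongr
          rcases hm with hm | ⟨hm, -⟩ <;> exact hm.trans (by gcongr)
      _ = 1 / (n : ℝ) := by field_simp
  obtain ⟨S, hUS, hS, hS', hSfam⟩ := exists_activeColumns hκ (by positivity) hU0 hm
  obtain ⟨ρ, hρ, hle, hclose⟩ := exists_fullyFactorized_le_smul_prior ha hb0 hB hd hA hU hV hUS hM
    (by positivity) hη1 ((div_le_one (by positivity)).mpr hn) hmη
    (fun x hx => one_le_ofReal_exp_varianceCost_mul_variancePDF_of_mem_Icc_one_two fam ha hκ hN hb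
      hbκ hx)
    (fun k hk x hx => one_le_ofReal_exp_varianceCost_mul_variancePDF_of_mem_Icc_small fam ha hκ hn
      hD hnN (hDn.trans hnN) hN hb hbκ (hSfam k hk) hx)
  have := isProbabilityMeasure_of_mem_fullyFactorized hρ
  have := isProbabilityMeasure_prior (d1 := d1) (d2 := d2) (m := m) fam ha hb0
    (by linarith : 1 < B)
  refine ⟨ρ, hρ, (klDiv_le_of_le_smul hle).trans (ENNReal.ofReal_le_ofReal ?_), hclose⟩
  exact sum_columnCost_le ha hA hκ hr hn (Real.log_le_log (by positivity) hnN) (one_half_le_log hN)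
    hD (Real.log_le_log (by positivity) (hDn.trans hnN)) hS hS'

end Oracle

section Conclusion

open InformationTheory

variable {n d1 d2 m r : ℕ} {A B K N a b κ lam : ℝ} {fam : VarianceFamily}
  {U : Matrix (Fin d1) (Fin m) ℝ} {V : Matrix (Fin d2) (Fin m) ℝ}

lemma isProbabilityMeasure_gibbs (π : Measure (Params d1 d2 m)) [IsProbabilityMeasure π]
    (hlam : 0 ≤ lam) (D : Fin n → Obs d1 d2) : IsProbabilityMeasure (gibbs π lam D) := by
  refine isProbabilityMeasure_tilted (.of_bound (C := 1) ?_ (.of_forall fun θ => ?_))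
  · exact Measurable.aestronglyMeasurable (by fun_prop)
  · rw [Real.norm_eq_abs, Real.abs_exp, Real.exp_le_one_iff, neg_mul, Left.neg_nonpos_iff]
    exact mul_nonneg hlam (empHingeRisk_nonneg _ _)

lemma ae_mem_paramSet_of_klDiv_gibbs_le {π ρ ρ' : Measure (Params d1 d2 m)}
    [IsProbabilityMeasure π] [IsFiniteMeasure ρ'] (hB : 0 ≤ B)
    (hπ : ∀ᵐ θ ∂π, θ ∈ paramSet d1 d2 m B) (hρ' : klDiv ρ' π ≠ ∞) {D : Fin n → Obs d1 d2}
    (hkl : klDiv ρ (gibbs π lam D) ≤ klDiv ρ' (gibbs π lam D)) :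
    ∀ᵐ θ ∂ρ, θ ∈ paramSet d1 d2 m B := by
  have hbound : ∀ᵐ θ ∂π, |-lam * empHingeRisk D (toMatrix θ)| ≤ |lam| * B := by
    filter_upwards [hπ] with θ hθ
    rw [abs_mul, abs_neg, abs_of_nonneg (empHingeRisk_nonneg _ _)]
    gcongr
    exact empHingeRisk_le hB D hθ
  have hρ'gibbs : klDiv ρ' (gibbs π lam D) ≠ ∞ :=
    (klDiv_tilted_right_ne_top_iff (by fun_prop) hbound).mpr hρ'
  have hρ : ρ ≪ gibbs π lam D := (klDiv_ne_top_iff.mp (ne_top_of_le_ne_top hρ'gibbs hkl)).1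
  exact (hρ.trans (tilted_absolutelyContinuous π _)) hπ

variable {P : Measure (Obs d1 d2)} [IsProbabilityMeasure P] {Ms : Matrix (Fin d1) (Fin d2) ℝ}

lemma integrable_hingeRisk_toMatrix {ρ : Measure (Params d1 d2 m)} [IsFiniteMeasure ρ]
    (hρ : ∀ᵐ θ ∂ρ, θ ∈ paramSet d1 d2 m B) :
    Integrable (fun θ => hingeRisk P (toMatrix θ)) ρ := by
  refine .of_bound (measurable_hingeRisk_toMatrix P).aestronglyMeasurable B ?_
  filter_upwards [hρ] with θ hθ
  rw [Real.norm_eq_abs, abs_of_nonneg (hingeRisk_nonneg _ _)]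
  exact hingeRisk_le P hθ

lemma integrable_misclassRisk_toMatrix (ρ : Measure (Params d1 d2 m)) [IsFiniteMeasure ρ] :
    Integrable (fun θ => misclassRisk P (toMatrix θ)) ρ := by
  refine .of_bound (measurable_misclassRisk_toMatrix P).aestronglyMeasurable 1
    (.of_forall fun θ => ?_)
  rw [Real.norm_eq_abs, abs_of_nonneg (misclassRisk_nonneg _ _)]
  exact misclassRisk_le_one P _

lemma integral_misclassRisk_toMatrix_le_one (ρ : Measure (Params d1 d2 m))
    [IsProbabilityMeasure ρ] : ∫ θ, misclassRisk P (toMatrix θ) ∂ρ ≤ 1 := by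
  simpa using integral_mono (integrable_misclassRisk_toMatrix ρ) (integrable_const 1)
    fun θ => misclassRisk_le_one P (toMatrix θ)

lemma integral_misclassRisk_toMatrix_sub_bayesRisk_le (hMs : IsBayesMatrix P Ms)
    {ρ : Measure (Params d1 d2 m)} [IsProbabilityMeasure ρ]
    (hρ : ∀ᵐ θ ∂ρ, θ ∈ paramSet d1 d2 m B) :
    ∫ θ, misclassRisk P (toMatrix θ) ∂ρ - bayesRisk P ≤
      ∫ θ, (hingeRisk P (toMatrix θ) - hingeRisk P Ms) ∂ρ := by
  calc ∫ θ, misclassRisk P (toMatrix θ) ∂ρ - bayesRisk P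
      = ∫ θ, (misclassRisk P (toMatrix θ) - bayesRisk P) ∂ρ := by
        rw [integral_sub (integrable_misclassRisk_toMatrix ρ) (integrable_const _)]
        simp
    _ ≤ _ := integral_mono ((integrable_misclassRisk_toMatrix ρ).sub (integrable_const _))
        ((integrable_hingeRisk_toMatrix hρ).sub (integrable_const _))
        fun θ => misclassRisk_sub_bayesRisk_le P hMs (toMatrix θ)

lemma misclassRisk_meanMatrix_sub_bayesRisk_le (hMs : IsBayesMatrix P Ms)
    {ρ : Measure (Params d1 d2 m)} [IsProbabilityMeasure ρ]
    (hρ : ∀ᵐ θ ∂ρ, θ ∈ paramSet d1 d2 m B) :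
    misclassRisk P (meanMatrix ρ) - bayesRisk P ≤
      ∫ θ, (hingeRisk P (toMatrix θ) - hingeRisk P Ms) ∂ρ := by
  have hint (i j) : Integrable (fun θ => toMatrix θ i j) ρ :=
    .of_bound (measurable_toMatrix_apply i j).aestronglyMeasurable (B - 1)
      (hρ.mono fun θ hθ => abs_toMatrix_le hθ i j)
  calc misclassRisk P (meanMatrix ρ) - bayesRisk P
      ≤ hingeRisk P (meanMatrix ρ) - hingeRisk P Ms := misclassRisk_sub_bayesRisk_le P hMs _
    _ ≤ ∫ θ, hingeRisk P (toMatrix θ) ∂ρ - hingeRisk P Ms := by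
        gcongr
        exact hingeRisk_meanMatrix_le P ρ hint
    _ = ∫ θ, (hingeRisk P (toMatrix θ) - hingeRisk P Ms) ∂ρ := by
        rw [integral_sub (integrable_hingeRisk_toMatrix hρ) (integrable_const _)]
        simp

lemma integral_sub_le_integral_of_forall_sub_le {Ω : Type*} [MeasurableSpace Ω]
    [DiscreteMeasurableSpace Ω] [Finite Ω] (ν : Measure Ω) [IsProbabilityMeasure ν]
    {X Y : Ω → ℝ} {c : ℝ} (h : ∀ ω, X ω - c ≤ Y ω) : ∫ ω, X ω ∂ν - c ≤ ∫ ω, Y ω ∂ν := by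
  calc ∫ ω, X ω ∂ν - c = ∫ ω, (X ω - c) ∂ν := by
        rw [integral_sub .of_finite .of_finite]
        simp
    _ ≤ ∫ ω, Y ω ∂ν := integral_mono .of_finite .of_finite h

/-- The constant `C` of the risk bounds. -/
noncomputable def rateConst (K B A a κ : ℝ) : ℝ :=
  2 * max (2 * K) B * competitorCost a A κ + 8

lemma le_rateConst (hB : 0 ≤ B) (ha : 0 < a) (hA : 0 ≤ A) (hκ : 1 ≤ κ) :
    8 ≤ rateConst K B A a κ := by
  have hcost := competitorCost_nonneg ha hA hκ
  have : 0 ≤ max (2 * K) B := hB.trans (le_max_right _ _)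
  exact le_add_of_nonneg_left (by positivity)

lemma one_le_rateConst_mul (hB : 0 ≤ B) (hA : 0 ≤ A) (ha : 0 < a) (hκ : 1 ≤ κ) (hN : 2 ≤ N)
    (hn : 0 < n) (hrn : n ≤ r * (d1 + d2)) :
    1 ≤ rateConst K B A a κ * (r * (d1 + d2) * Real.log N / n) := by
  have hrn' : (n : ℝ) ≤ r * (d1 + d2) := by exact_mod_cast hrn
  have hrate : 1 / 2 ≤ r * (d1 + d2) * Real.log N / n := by
    rw [le_div_iff₀ (Nat.cast_pos.mpr hn), mul_comm]
    exact mul_le_mul hrn' (one_half_le_log hN) (by norm_num) (by positivity)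
  calc (1 : ℝ) ≤ 8 * (1 / 2) := by norm_num
    _ ≤ _ := mul_le_mul (le_rateConst hB ha hA hκ) hrate (by norm_num)
        (by linarith [le_rateConst (K := K) hB ha hA hκ])

lemma integral_excess_le_rate (hK : 0 < K) (hB : 2 ≤ B) (hA : 0 ≤ A) (ha : 0 < a) (hκ : 1 ≤ κ)
    (hN : 2 ≤ N) (hnN : n ≤ N) (hd : 1 ≤ d1 + d2) (hr : 1 ≤ r) (hrn : r * (d1 + d2) ≤ n)
    (hb : 1 / (κ * N ^ κ) ≤ b) (hbκ : b ≤ κ)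
    (hm : (m : ℝ) ≤ κ * r ∨ ((m : ℝ) ≤ κ * (d1 + d2) ∧ (fam = .gamma ∨ b ≤ κ / N ^ 4)))
    (hUV : (U, V) ∈ factorClass d1 d2 m r A) (hBayes : IsBayesMatrix P (U * V.transpose))
    (hbern : ∀ θ ∈ paramSet d1 d2 m B, sqDist P (toMatrix θ) (U * V.transpose) ≤
      K * (hingeRisk P (toMatrix θ) - hingeRisk P (U * V.transpose)))
    {ρ : (Fin n → Obs d1 d2) → Measure (Params d1 d2 m)} [∀ D, IsProbabilityMeasure (ρ D)]
    (hρ : ∀ D, ∀ ρ' ∈ fullyFactorized d1 d2 m,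
      klDiv (ρ D) (gibbs (prior d1 d2 m fam a b B) (n / max (2 * K) B) D) ≤
        klDiv ρ' (gibbs (prior d1 d2 m fam a b B) (n / max (2 * K) B) D)) :
    (∀ D, ∀ᵐ θ ∂(ρ D), θ ∈ paramSet d1 d2 m B) ∧
      ∫ D, (∫ θ, (hingeRisk P (toMatrix θ) - hingeRisk P (U * V.transpose)) ∂(ρ D))
          ∂(Measure.pi fun _ : Fin n => P) ≤
        rateConst K B A a κ * (r * (d1 + d2) * Real.log N / n) := by
  have hpm (i j) := (hBayes i j).1
  obtain ⟨ρ', hρ'F, hρ'kl, hρ'close⟩ := exists_fullyFactorized_klDiv_prior_le hA ha hκ hB hN hnN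
    hd hr hrn hb hbκ hm hUV fun i j => (abs_eq one_pos.le).mpr (hpm i j)
  have hκN : 0 < 1 / (κ * N ^ κ) := by positivity
  have := isProbabilityMeasure_of_mem_fullyFactorized hρ'F
  have := isProbabilityMeasure_prior (d1 := d1) (d2 := d2) (m := m) fam ha (hκN.trans_le hb)
    (by linarith : 1 < B)
  have hn : (0 : ℝ) < n :=
    Nat.cast_pos.mpr ((Nat.mul_pos hr hd).trans_le hrn)
  have hmax : 0 < max (2 * K) B := by positivity
  have hrate : 1 ≤ 2 * (r * (d1 + d2) * Real.log N) := by
    have hrd : (1 : ℝ) ≤ r * (d1 + d2) := by exact_mod_cast Nat.mul_pos hr hd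
    nlinarith [one_half_le_log hN]
  have hcost : 0 ≤ competitorCost a A κ * (r * (d1 + d2) * Real.log N) :=
    mul_nonneg (competitorCost_nonneg ha hA hκ) (by linarith)
  refine ⟨fun D => ae_mem_paramSet_of_klDiv_gibbs_le (by positivity)
    (ae_mem_paramSet_prior fam) (ne_top_of_le_ne_top ENNReal.ofReal_ne_top hρ'kl)
    (hρ D ρ' hρ'F), ?_⟩
  refine (integral_excess_le_of_klDiv_gibbs_le hK hB (by positivity)
    (by rw [div_mul_eq_mul_div, div_le_iff₀ hmax]; gcongr; exact le_max_left _ _)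
    (by rw [div_mul_eq_mul_div, div_le_iff₀ hmax]; gcongr; exact le_max_right _ _)
    hpm hbern (ae_mem_paramSet_prior fam) hρ'kl hcost (by positivity) hρ'close
    fun D => hρ D ρ' hρ'F).trans ?_
  calc 2 * (competitorCost a A κ * (r * (d1 + d2) * Real.log N) / (n / max (2 * K) B) +
        2 * (1 / n))
      = (2 * max (2 * K) B * competitorCost a A κ * (r * (d1 + d2) * Real.log N) + 4 * 1) / n := by
        field_simp
        ring
    _ ≤ (2 * max (2 * K) B * competitorCost a A κ * (r * (d1 + d2) * Real.log N) +
          4 * (2 * (r * (d1 + d2) * Real.log N))) / n := by gcongr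
    _ = rateConst K B A a κ * (r * (d1 + d2) * Real.log N / n) := by
        rw [rateConst]
        ring

lemma integral_sub_bayesRisk_le_rate (hK : 0 < K) (hB : 2 ≤ B) (hA : 0 ≤ A) (ha : 0 < a)
    (hκ : 1 ≤ κ) (hN : 2 ≤ N) (hnN : n ≤ N) (hn : 0 < n) (hd : 1 ≤ d1 + d2) (hr : 1 ≤ r)
    (hb : 1 / (κ * N ^ κ) ≤ b) (hbκ : b ≤ κ)
    (hm : (m : ℝ) ≤ κ * r ∨ ((m : ℝ) ≤ κ * (d1 + d2) ∧ (fam = .gamma ∨ b ≤ κ / N ^ 4)))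
    (hUV : (U, V) ∈ factorClass d1 d2 m r A) (hBayes : IsBayesMatrix P (U * V.transpose))
    (hbern : ∀ θ ∈ paramSet d1 d2 m B, sqDist P (toMatrix θ) (U * V.transpose) ≤
      K * (hingeRisk P (toMatrix θ) - hingeRisk P (U * V.transpose)))
    {ρ : (Fin n → Obs d1 d2) → Measure (Params d1 d2 m)} [∀ D, IsProbabilityMeasure (ρ D)]
    (hρ : ∀ D, ∀ ρ' ∈ fullyFactorized d1 d2 m,
      klDiv (ρ D) (gibbs (prior d1 d2 m fam a b B) (n / max (2 * K) B) D) ≤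
        klDiv ρ' (gibbs (prior d1 d2 m fam a b B) (n / max (2 * K) B) D))
    {X : (Fin n → Obs d1 d2) → ℝ} (hX1 : ∀ D, X D ≤ 1)
    (hX : ∀ D, (∀ᵐ θ ∂(ρ D), θ ∈ paramSet d1 d2 m B) → X D - bayesRisk P ≤
      ∫ θ, (hingeRisk P (toMatrix θ) - hingeRisk P (U * V.transpose)) ∂(ρ D)) :
    ∫ D, X D ∂(Measure.pi fun _ : Fin n => P) - bayesRisk P ≤
      rateConst K B A a κ * (r * (d1 + d2) * Real.log N / n) := by
  rcases le_total n (r * (d1 + d2)) with hrn | hrn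
  · refine le_trans ?_ (one_le_rateConst_mul (by linarith) hA ha hκ hN hn hrn)
    simpa using integral_sub_le_integral_of_forall_sub_le (Measure.pi fun _ : Fin n => P)
      (Y := fun _ => 1) fun D => (sub_le_self _ (bayesRisk_nonneg P)).trans (hX1 D)
  · obtain ⟨hΘ, hrate⟩ := integral_excess_le_rate hK hB hA ha hκ hN hnN hd hr hrn hb hbκ hm hUV
      hBayes hbern hρ
    exact (integral_sub_le_integral_of_forall_sub_le _ fun D => hX D (hΘ D)).trans hrate

end Conclusion

end OneBit

theorem theorem4_general (K B A a κ : ℝ) (hK : 0 < K) (hB : 2 ≤ B) (hA : 0 < A) (ha : 0 < a)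
    (hκ : 1 ≤ κ) :
    ∃ C : ℝ, 0 < C ∧
      ∀ (n d1 d2 m r : ℕ) (_hN : 2 ≤ n * d1 * d2) (_hr : 1 ≤ r)
        (P : Measure (OneBit.Obs d1 d2)) (_hP : IsProbabilityMeasure P)
        (fam : OneBit.VarianceFamily) (b : ℝ)
        (_hb : 1 / (κ * ((n * d1 * d2 : ℕ) : ℝ) ^ κ) ≤ b ∧ b ≤ κ)
        (_hm : (m : ℝ) ≤ κ * r ∨
          ((m : ℝ) ≤ κ * (d1 + d2) ∧
            (fam = OneBit.VarianceFamily.gamma ∨ b ≤ κ / ((n * d1 * d2 : ℕ) : ℝ) ^ 4)))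
        (U : Matrix (Fin d1) (Fin m) ℝ) (V : Matrix (Fin d2) (Fin m) ℝ)
        (_hUV : (U, V) ∈ OneBit.factorClass d1 d2 m r A)
        (_hBayes : OneBit.IsBayesMatrix P (U * V.transpose))
        (_hBernstein : ∀ θ ∈ OneBit.paramSet d1 d2 m B,
          OneBit.sqDist P (OneBit.toMatrix θ) (U * V.transpose) ≤
            K * (OneBit.hingeRisk P (OneBit.toMatrix θ) - OneBit.hingeRisk P (U * V.transpose)))
        (lam : ℝ) (_hlam : lam = n / max (2 * K) B)
        (π : Measure (OneBit.Params d1 d2 m)) (_hπ : π = OneBit.prior d1 d2 m fam a b B)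
        (F : Set (Measure (OneBit.Params d1 d2 m)))
        (_hFprob : ∀ ρ ∈ F, IsProbabilityMeasure ρ)
        (_hF : OneBit.fullyFactorized d1 d2 m ⊆ F)
        (ρVB : (Fin n → OneBit.Obs d1 d2) → Measure (OneBit.Params d1 d2 m))
        (_hVB : ∀ D, OneBit.IsVBApprox F (OneBit.gibbs π lam D) (ρVB D)),
        (∫ D, (∫ θ, OneBit.misclassRisk P (OneBit.toMatrix θ) ∂(ρVB D))
              ∂(Measure.pi fun _ : Fin n => P)) - OneBit.bayesRisk P
            ≤ C * (r * (d1 + d2) * Real.log (n * d1 * d2) / n) ∧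
        (∫ D, OneBit.misclassRisk P (OneBit.meanMatrix (ρVB D))
              ∂(Measure.pi fun _ : Fin n => P)) - OneBit.bayesRisk P
            ≤ C * (r * (d1 + d2) * Real.log (n * d1 * d2) / n) ∧
        (∫ D, OneBit.misclassRisk P (OneBit.meanMatrix (OneBit.gibbs π lam D))
              ∂(Measure.pi fun _ : Fin n => P)) - OneBit.bayesRisk P
            ≤ C * (r * (d1 + d2) * Real.log (n * d1 * d2) / n) := by
  refine ⟨OneBit.rateConst K B A a κ, ?_, ?_⟩
  · linarith [OneBit.le_rateConst (K := K) (by linarith : 0 ≤ B) ha hA.le hκ]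
  intro n d1 d2 m r hN hr P _ fam b ⟨hb, hbκ⟩ hm U V hUV hBayes hbern lam hlam π hπ F hFprob hF
    ρVB hVB
  subst hlam hπ
  obtain ⟨⟨hn, hd1⟩, hd2⟩ : (0 < n ∧ 0 < d1) ∧ 0 < d2 := by
    simpa only [Nat.mul_pos_iff_of_pos_left, CanonicallyOrderedAdd.mul_pos] using
      two_pos.trans_le hN
  have hN' : (2 : ℝ) ≤ (n * d1 * d2 : ℕ) := by exact_mod_cast hN
  have hnN : (n : ℝ) ≤ (n * d1 * d2 : ℕ) := by
    exact_mod_cast (Nat.le_mul_of_pos_right n hd1).trans (Nat.le_mul_of_pos_right _ hd2)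
  have hρVB (D) : IsProbabilityMeasure (ρVB D) := hFprob _ (hVB D).1
  have hπ := OneBit.isProbabilityMeasure_prior (d1 := d1) (d2 := d2) (m := m) fam ha
    (lt_of_lt_of_le (by positivity) hb) (by linarith : 1 < B)
  have hgibbs := OneBit.isProbabilityMeasure_gibbs (n := n) (OneBit.prior d1 d2 m fam a b B)
    (show 0 ≤ n / max (2 * K) B by positivity)
  rw [show (n * d1 * d2 : ℝ) = (n * d1 * d2 : ℕ) by push_cast; rfl]
  refine ⟨?_, ?_, ?_⟩
  · exact OneBit.integral_sub_bayesRisk_le_rate hK hB hA.le ha hκ hN' hnN hn (by omega) hr hb hbκ hm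
      hUV hBayes hbern (fun D ρ' hρ' => (hVB D).2 ρ' (hF hρ'))
      (fun D => OneBit.integral_misclassRisk_toMatrix_le_one (ρVB D))
      fun D => OneBit.integral_misclassRisk_toMatrix_sub_bayesRisk_le hBayes
  · exact OneBit.integral_sub_bayesRisk_le_rate hK hB hA.le ha hκ hN' hnN hn (by omega) hr hb hbκ hm
      hUV hBayes hbern (fun D ρ' hρ' => (hVB D).2 ρ' (hF hρ'))
      (fun D => OneBit.misclassRisk_le_one P _)
      fun D => OneBit.misclassRisk_meanMatrix_sub_bayesRisk_le hBayes
  · exact OneBit.integral_sub_bayesRisk_le_rate hK hB hA.le ha hκ hN' hnN hn (by omega) hr hb hbκ hm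
      hUV hBayes hbern (fun D ρ' _ => (InformationTheory.klDiv_self _).trans_le zero_le)
      (fun D => OneBit.misclassRisk_le_one P _)
      fun D => OneBit.misclassRisk_meanMatrix_sub_bayesRisk_le hBayes

theorem theorem4 (K B A a κ : ℝ) (hK : 0 < K) (hB : 2 ≤ B) (hA : 0 < A) (ha : 0 < a) (hκ : 1 ≤ κ) :
    ∃ C : ℝ, 0 < C ∧
      ∀ (n d1 d2 m r : ℕ) (_hN : 2 ≤ n * d1 * d2) (_hr : 1 ≤ r)
        (P : Measure (OneBit.Obs d1 d2)) (_hP : IsProbabilityMeasure P)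
        (fam : OneBit.VarianceFamily) (b : ℝ)
        (_hb : 1 / (κ * ((n * d1 * d2 : ℕ) : ℝ) ^ κ) ≤ b ∧ b ≤ κ)
        (_hm : (m : ℝ) ≤ κ * r ∨
          ((m : ℝ) ≤ κ * (d1 + d2) ∧
            (fam = OneBit.VarianceFamily.gamma ∨ b ≤ κ / ((n * d1 * d2 : ℕ) : ℝ) ^ 4)))
        (U : Matrix (Fin d1) (Fin m) ℝ) (V : Matrix (Fin d2) (Fin m) ℝ)
        (_hUV : (U, V) ∈ OneBit.factorClass d1 d2 m r A)
        (_hBayes : OneBit.IsBayesMatrix P (U * V.transpose))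
        (_hBernstein : ∀ θ ∈ OneBit.paramSet d1 d2 m B,
          OneBit.sqDist P (OneBit.toMatrix θ) (U * V.transpose) ≤
            K * (OneBit.hingeRisk P (OneBit.toMatrix θ) - OneBit.hingeRisk P (U * V.transpose)))
        (c : ℝ) (_hc : 0 < c) (_hmargin : OneBit.MarginCondition P c)
        (lam : ℝ) (_hlam : lam = n / max (2 * K) B)
        (π : Measure (OneBit.Params d1 d2 m)) (_hπ : π = OneBit.prior d1 d2 m fam a b B)
        (F : Set (Measure (OneBit.Params d1 d2 m)))
        (_hFprob : ∀ ρ ∈ F, IsProbabilityMeasure ρ)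
        (_hF : OneBit.fullyFactorized d1 d2 m ⊆ F)
        (ρVB : (Fin n → OneBit.Obs d1 d2) → Measure (OneBit.Params d1 d2 m))
        (_hVB : ∀ D, OneBit.IsVBApprox F (OneBit.gibbs π lam D) (ρVB D)),
        (∫ D, (∫ θ, OneBit.misclassRisk P (OneBit.toMatrix θ) ∂(ρVB D))
              ∂(Measure.pi fun _ : Fin n => P)) - OneBit.bayesRisk P
            ≤ C * (r * (d1 + d2) * Real.log (n * d1 * d2) / n) ∧
        (∫ D, OneBit.misclassRisk P (OneBit.meanMatrix (ρVB D))
              ∂(Measure.pi fun _ : Fin n => P)) - OneBit.bayesRisk P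
            ≤ C * (r * (d1 + d2) * Real.log (n * d1 * d2) / n) ∧
        (∫ D, OneBit.misclassRisk P (OneBit.meanMatrix (OneBit.gibbs π lam D))
              ∂(Measure.pi fun _ : Fin n => P)) - OneBit.bayesRisk P
            ≤ C * (r * (d1 + d2) * Real.log (n * d1 * d2) / n) := by
  obtain ⟨C, hC, hbound⟩ := theorem4_general K B A a κ hK hB hA ha hκ
  exact ⟨C, hC, fun n d1 d2 m r hN hr P hP fam b hb hm U V hUV hBayes hbern _ _ _ =>
    hbound n d1 d2 m r hN hr P hP fam b hb hm U V hUV hBayes hbern⟩
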